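/- **Setting.** There are $C>1$ cells; in each cell a base station (BS) with $M$ antennas serves $K$ single-antenna users. Let $g_{k,c,c'}\ge 0$ be fixed path gains and let ${\bf h}_{k,c,c'}[t]\in\mathbb C^M$ be the channel vector from BS $c'$ to user $k$ of cell $c$ in slot $t$; all these vectors are independent over $(t,k,c,c')$, with i.i.d. $\mathcal{CN}(0,1)$ components. Put ${\bf H}_c[t]=[{\bf h}_{1,c,c}[t],\dots,{\bf h}_{K,c,c}[t]]$. A scheduling decision for channel matrix ${\bf H}=[{\bf h}_1,\dots,{\bf h}_K]$ is a pair of a power vector ${\bf P}\ge 0$ with $\sum_kP_k\le 1$ and at most $\min\{M,K\}$ active users (those in $\mathcal S=\{k:P_k>0\}$), and a rate vector ${\bf r}\ge 0$. Let ${\bf v}_k$ ($k\in\mathcal S$) be the zero-forcing steering vectors, i.e. the normalized columns of ${\bf H}_{\mathcal S}({\bf H}_{\mathcal S}^{\sf H}{\bf H}_{\mathcal S})^{-1}$, where ${\bf H}_{\mathcal S}$ consists of the columns of ${\bf H}$ in $\mathcal S$; the transmit covariance matrix is $\Sigma=\sum_{k\in\mathcal S}P_k{\bf v}_k{\bf v}_k^{\sf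 H}$. For interference power $\chi$ and gain $g$ let $I_k(g,{\bf H},\chi,\Sigma)=\log_2\bigl(1+\tfrac{g|{\bf h}_k^{\sf H}{\bf v}_k|^2P_k}{1+\chi}\bigr)$ (equal to $0$ if $P_k=0$); the service rate of user $k$ is the outage rate $r_k\,\mathbf 1\{r_k\le I_k\}$. A stationary policy is a (possibly randomized) measurable map from channel matrices to scheduling decisions. Fix a reference cell $c$ and a stationary policy $\gamma_{c'}$ for every other cell $c'\ne c$ (the randomizations being independent over slots and cells and independent of the channels). These fix the joint law of the interference powers $\chi_{k,c}[t]=\sum_{c'\ne c}g_{k,c,c'}{\bf h}_{k,c,c'}^{\sf H}[t]\,\Sigma_{c'}[t]\,{\bf h}_{k,c,c'}[t]$. Let $\mathcal R_c$ be the closure of the convex hull of the union, over all stationary policies of cell $c$, of the sets $\{\overline{\bf R}\in\mathbb R_+^K:\overline R_k\le \mathbb E[\text{service rate of user }k]\ \forall k\}$. Let $U:\mathbb R_+^K\to[-\infty,\infty)$ be continuous (as an extended-real-valued function), concave and entry-wise non-decreasing. **Policy.** Fix $V>0$ and $A_{\max}>0$. The adaptive policy $\gamma_c^\star$ keeps virtual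 queues $Q_k[t]$, with an arbitrary deterministic initial state $Q_k[0]\ge0$. In each slot $t$, for the current ${\bf H}_c[t]$ and ${\bf Q}[t]$, it (1) chooses a scheduling decision that maximizes $\sum_kQ_k[t]\,\mathbb E\bigl[r_k\mathbf 1\{r_k\le I_k(g_{k,c,c},{\bf H}_c[t],\chi_{k,c}[t],\Sigma)\}\,\big|\,{\bf H}_c[t]\bigr]$ (where ${\bf Q}[t]$ and the decision are treated as fixed); (2) chooses ${\bf A}[t]\in[0,A_{\max}]^K$ that maximizes $V\,U({\bf A})-\sum_kA_kQ_k[t]$; and (3) updates $Q_k[t+1]=\max\{0,Q_k[t]-R_k[t]\}+A_k[t]$, where $R_k[t]$ is the service rate obtained in slot $t$. Here ties are broken by any fixed measurable rule depending on $({\bf H}_c[t],{\bf Q}[t])$, respectively on ${\bf Q}[t]$. **Theorem.** Assume that some ${\bf r}\in\mathcal R_c$ with strictly positive entries satisfies $U({\bf r}/2)>-\infty$. Then the problem of maximizing $U$ over $\mathcal R_c\cap[0,A_{\max}]^K$ has a solution, and every solution $\overline{\bf R}^\star(A_{\max})$ has the following properties, where $$\kappa=\frac12\Bigl(KA_{\max}^2+\sum_{k=1}^K\mathbb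 E\Bigl[\log_2^2\Bigl(1+\frac{g_{k,c,c}|{\bf h}_{k,c,c}|^2}{1+\chi_{k,c}}\Bigr)\Bigr]\Bigr).$$ (a) Almost surely, $$\liminf_{t\to\infty}U\Bigl(\frac1t\sum_{\tau=1}^t{\bf R}[\tau]\Bigr)\ \ge\ U(\overline{\bf R}^\star(A_{\max}))-\frac{\kappa}{V}.$$ (b) Suppose that $U(\overline{\bf R}^\star(A_{\max}))>-\infty$ (which holds, for example, if $A_{\max}\ge r_k/2$ for all $k$). Then for every $\overline{\bf R}\in\mathcal R_c\cap[0,A_{\max}]^K$ and every $\beta\in[0,1)$, $$\limsup_{t\to\infty}\frac1t\sum_{\tau=1}^t\sum_{k=1}^K\overline R_k\,\mathbb E[Q_k[\tau]]\ \le\ \frac{\kappa+V\bigl[U(\overline{\bf R}^\star(A_{\max}))-U(\beta\overline{\bf R})\bigr]}{1-\beta}$$ (the right-hand side being $+\infty$ if $U(\beta\overline{\bf R})=-\infty$), and all virtual queues are strongly stable: $\limsup_{t\to\infty}\frac1t\sum_{\tau=1}^t\mathbb E[Q_k[\tau]]<\infty$ for every $k$, all these expectations being finite. -/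

import Mathlib

open MeasureTheory ProbabilityTheory Filter Topology
open scoped NNReal ENNReal Matrix

namespace MultiCell

noncomputable section

/-- The circularly symmetric complex Gaussian law `CN(0,1)`: independent real and imaginary
parts, each of variance `1/2`. -/
def cGauss : Measure ℂ :=
  ((gaussianReal 0 (1 / 2)).prod (gaussianReal 0 (1 / 2))).map
    (fun p : ℝ × ℝ => (⟨p.1, p.2⟩ : ℂ))

/-- The own-cell channel of one slot: `H k` is the channel vector (in `ℂ^M`) of user `k`, that is
the `k`-th column of the `M × K` channel matrix. -/
abbrev Channel (M K : ℕ) := Fin K → Fin M → ℂ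

/-- All the randomness of one slot of a system with `C` cells, `K` users per cell and `M` antennas
per base station (BS): `w.1 k c c'` is the channel vector from BS `c'` to user `(k, c)`, and
`w.2 c'` is the seed that BS `c'` uses to randomize its scheduling decision. -/
abbrev Slot (M K C : ℕ) := (Fin K → Fin C → Fin C → Fin M → ℂ) × (Fin C → unitInterval)

/-- The law of one slot: all channel coefficients are i.i.d. `CN(0,1)`, the seeds are i.i.d. uniform
on `[0,1]`, independent of the channels. -/
def slotLaw (M K C : ℕ) : Measure (Slot M K C) :=
  (Measure.pi fun _ : Fin K => Measure.pi fun _ : Fin C => Measure.pi fun _ : Fin C =>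
      Measure.pi fun _ : Fin M => cGauss).prod
    (Measure.pi fun _ : Fin C => (volume : Measure unitInterval))

/-- The channel matrix of cell `c`. -/
def ownChannel {M K C : ℕ} (c : Fin C) (w : Slot M K C) : Channel M K := fun k => w.1 k c c

/-- The squared Euclidean norm of a vector of `ℂ^M`. -/
def sqNorm {M : ℕ} (x : Fin M → ℂ) : ℝ := ∑ m, ‖x m‖ ^ 2

/-- The (unnormalized) zero-forcing direction of user `k` for the set `S` of active users: the
column belonging to `k` of `H_S (H_Sᴴ H_S)⁻¹`, i.e. of the (conjugate transposed) Moore-Penrose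
pseudoinverse of `H_S`, where `H_S` has the columns `H j`, `j ∈ S`. (For `|S| ≤ M`, `H_S` has full
column rank for almost every `H`; on the remaining null set the value is `0`.) -/
def zfColumn {M K : ℕ} (H : Channel M K) (S : Finset (Fin K)) (k : Fin K) : Fin M → ℂ :=
  let HS : Matrix (Fin M) S ℂ := Matrix.of fun m j => H j.1 m
  if hk : k ∈ S then fun m => (HS * (HSᴴ * HS)⁻¹) m ⟨k, hk⟩ else 0

/-- The unit-norm zero-forcing steering vector. -/
def steering {M K : ℕ} (H : Channel M K) (S : Finset (Fin K)) (k : Fin K) : Fin M → ℂ :=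
  fun m => zfColumn H S k m / ((Real.sqrt (sqNorm (zfColumn H S k)) : ℝ) : ℂ)

/-- A scheduling decision `(P, r)`: the vector of powers and the vector of allocated rates. Together
with the channel matrix, the powers determine the transmit covariance matrix. -/
abbrev Action (K : ℕ) := (Fin K → ℝ) × (Fin K → ℝ)

/-- The set of active users: those with positive power. -/
def active {K : ℕ} (P : Fin K → ℝ) : Finset (Fin K) :=
  Finset.univ.filter fun k => 0 < P k

/-- Feasible scheduling decisions: non-negative powers of sum at most one, at most `min {M, K}`
active users, non-negative rates. -/
def Feasible (M : ℕ) {K : ℕ} (a : Action K) : Prop :=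
  (∀ k, 0 ≤ a.1 k) ∧ ∑ k, a.1 k ≤ 1 ∧ (active a.1).card ≤ min M K ∧ ∀ k, 0 ≤ a.2 k

/-- The transmit covariance matrix `∑ₖ Pₖ vₖ vₖᴴ`. -/
def txCov {M K : ℕ} (H : Channel M K) (P : Fin K → ℝ) : Matrix (Fin M) (Fin M) ℂ :=
  ∑ k, (P k : ℂ) •
    Matrix.vecMulVec (steering H (active P) k) (star (steering H (active P) k))

/-- A feasible (possibly randomized) stationary scheduling policy: a measurable map from the channel
matrix and a uniform seed to feasible decisions. -/
structure Policy (M K : ℕ) where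
  act : Channel M K → unitInterval → Action K
  measurable_act : Measurable fun p : Channel M K × unitInterval => act p.1 p.2
  feasible : ∀ H u, Feasible M (act H u)

/-- The inter-cell interference power at user `(k, c)`, when the BSs `c' ≠ c` apply the policies
`γ`: `∑_{c' ≠ c} g_{k,c,c'} h_{k,c,c'}ᴴ Σ_{c'} h_{k,c,c'}`. -/
def ici {M K C : ℕ} (g : Fin K → Fin C → Fin C → ℝ) (c : Fin C)
    (γ : {c' : Fin C // c' ≠ c} → Policy M K) (w : Slot M K C) (k : Fin K) : ℝ :=
  ∑ c' : {c' : Fin C // c' ≠ c},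
    g k c c' * (star (w.1 k c c') ⬝ᵥ
      (txCov (ownChannel c'.1 w) ((γ c').act (ownChannel c'.1 w) (w.2 c')).1 *ᵥ
        w.1 k c c')).re

/-- The mutual information (in bits) of user `k`, for own path gain `g` and interference power
`χ`. -/
def mutualInfo {M K : ℕ} (g : ℝ) (H : Channel M K) (χ : ℝ) (P : Fin K → ℝ) (k : Fin K) : ℝ :=
  Real.logb 2 (1 + g * ‖star (H k) ⬝ᵥ steering H (active P) k‖ ^ 2 * P k / (1 + χ))

open Classical in
/-- The outage rate `rₖ 1{rₖ ≤ Iₖ}`, the service rate of user `k`. -/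
def outageRate {M K : ℕ} (g : ℝ) (H : Channel M K) (χ : ℝ) (a : Action K) (k : Fin K) : ℝ :=
  if a.2 k ≤ mutualInfo g H χ a.1 k then a.2 k else 0

/-- The throughput of user `k` of cell `c` under the stationary policy `η`, when the other cells
apply `γ`. -/
def throughput {M K C : ℕ} (g : Fin K → Fin C → Fin C → ℝ) (c : Fin C)
    (γ : {c' : Fin C // c' ≠ c} → Policy M K) (η : Policy M K) (k : Fin K) : ℝ :=
  ∫ w, outageRate (g k c c) (ownChannel c w) (ici g c γ w k)
    (η.act (ownChannel c w) (w.2 c)) k ∂(slotLaw M K C)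

/-- The region of achievable throughputs of cell `c`: the closure of the convex hull of the union,
over all feasible stationary policies, of the boxes below the throughput vectors. -/
def region {M K C : ℕ} (g : Fin K → Fin C → Fin C → ℝ) (c : Fin C)
    (γ : {c' : Fin C // c' ≠ c} → Policy M K) : Set (Fin K → ℝ) :=
  closure (convexHull ℝ (⋃ η : Policy M K,
    {R : Fin K → ℝ | ∀ k, 0 ≤ R k ∧ R k ≤ throughput g c γ η k}))

/-- The box `[0, A]^K`. -/
def box (K : ℕ) (A : ℝ) : Set (Fin K → ℝ) := {x | ∀ k, 0 ≤ x k ∧ x k ≤ A}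

/-- `R` solves: maximize `U` over the throughput region intersected with `[0, A]^K`. -/
def IsBoxOptimal {M K C : ℕ} (g : Fin K → Fin C → Fin C → ℝ) (c : Fin C)
    (γ : {c' : Fin C // c' ≠ c} → Policy M K) (U : (Fin K → ℝ) → EReal) (A : ℝ)
    (R : Fin K → ℝ) : Prop :=
  R ∈ region g c γ ∩ box K A ∧ ∀ x ∈ region g c γ ∩ box K A, U x ≤ U R

/-- Concavity on the non-negative orthant of a function with values in `[-∞, ∞)`. -/
def ConcaveOnOrthant {K : ℕ} (U : (Fin K → ℝ) → EReal) : Prop :=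
  ∀ x y : Fin K → ℝ, 0 ≤ x → 0 ≤ y → ∀ a b : ℝ, 0 ≤ a → 0 ≤ b → a + b = 1 →
    (a : EReal) * U x + (b : EReal) * U y ≤ U (a • x + b • y)

/-- The weighted conditional average sum rate `∑ₖ qₖ E[rₖ 1{rₖ ≤ Iₖ} | H]` of the decision `a`. As
the interference powers are independent of the own channel matrix, the conditional expectation given
`H` is the expectation over the interference powers alone. -/
def weightedRate {M K C : ℕ} (g : Fin K → Fin C → Fin C → ℝ) (c : Fin C)
    (γ : {c' : Fin C // c' ≠ c} → Policy M K) (H : Channel M K) (q : Fin K → ℝ)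
    (a : Action K) : ℝ :=
  ∑ k, q k * ∫ w, outageRate (g k c c) H (ici g c γ w k) a k ∂(slotLaw M K C)

/-- The adaptive policy with parameters `V` and `A` (any measurable choice of the solutions of its
two maximization problems). In each slot, given the channel matrix `H` (up to a null set) and the
virtual queues `q`, the decision maximizes the weighted conditional average sum rate, and the virtual arrivals
maximize `V U(x) - ∑ₖ xₖ qₖ` over `[0, A]^K`. -/
structure AdaptivePolicy {M K C : ℕ} (g : Fin K → Fin C → Fin C → ℝ) (c : Fin C)
    (γ : {c' : Fin C // c' ≠ c} → Policy M K) (U : (Fin K → ℝ) → EReal) (V A : ℝ) where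
  act : Channel M K → (Fin K → ℝ) → Action K
  arrival : (Fin K → ℝ) → (Fin K → ℝ)
  measurable_act : Measurable fun p : Channel M K × (Fin K → ℝ) => act p.1 p.2
  measurable_arrival : Measurable arrival
  feasible : ∀ H q, Feasible M (act H q)
  act_optimal : ∀ᵐ H ∂((slotLaw M K C).map (ownChannel c)),
    ∀ q : Fin K → ℝ, 0 ≤ q → ∀ a : Action K, Feasible M a →
    weightedRate g c γ H q a ≤ weightedRate g c γ H q (act H q)
  arrival_mem : ∀ q, arrival q ∈ box K A
  arrival_optimal : ∀ q : Fin K → ℝ, 0 ≤ q → ∀ x ∈ box K A,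
    (V : EReal) * U x - ((∑ k, x k * q k : ℝ) : EReal) ≤
      (V : EReal) * U (arrival q) - ((∑ k, arrival q k * q k : ℝ) : EReal)

/-- The virtual queues `Q[t]` along a sequence `w` of slots, from the initial state `q₀`:
`Qₖ[t+1] = max {0, Qₖ[t] - Rₖ[t]} + Aₖ[t]`. -/
def AdaptivePolicy.queue {M K C : ℕ} {g : Fin K → Fin C → Fin C → ℝ} {c : Fin C}
    {γ : {c' : Fin C // c' ≠ c} → Policy M K} {U : (Fin K → ℝ) → EReal} {V A : ℝ}
    (π : AdaptivePolicy g c γ U V A) (q₀ : Fin K → ℝ) (w : ℕ → Slot M K C) :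
    ℕ → Fin K → ℝ
  | 0 => q₀
  | t + 1 => fun k =>
      max 0 (π.queue q₀ w t k -
        outageRate (g k c c) (ownChannel c (w t)) (ici g c γ (w t) k)
          (π.act (ownChannel c (w t)) (π.queue q₀ w t)) k)
      + π.arrival (π.queue q₀ w t) k

/-- The service rates `R[t]` under the adaptive policy. -/
def AdaptivePolicy.rate {M K C : ℕ} {g : Fin K → Fin C → Fin C → ℝ} {c : Fin C}
    {γ : {c' : Fin C // c' ≠ c} → Policy M K} {U : (Fin K → ℝ) → EReal} {V A : ℝ}
    (π : AdaptivePolicy g c γ U V A) (q₀ : Fin K → ℝ) (w : ℕ → Slot M K C)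
    (t : ℕ) (k : Fin K) : ℝ :=
  outageRate (g k c c) (ownChannel c (w t)) (ici g c γ (w t) k)
    (π.act (ownChannel c (w t)) (π.queue q₀ w t)) k

/-- The constant `κ`. -/
def kappa {M K C : ℕ} (g : Fin K → Fin C → Fin C → ℝ) (c : Fin C)
    (γ : {c' : Fin C // c' ≠ c} → Policy M K) (A : ℝ) : ℝ :=
  (1 / 2) * ((K : ℝ) * A ^ 2 + ∑ k, ∫ w,
    (Real.logb 2 (1 + g k c c * sqNorm (w.1 k c c) / (1 + ici g c γ w k))) ^ 2
      ∂(slotLaw M K C))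

/-- Strong stability of a queue: its time-averaged expected size has a finite limsup. -/
def StronglyStable {Ω : Type*} [MeasurableSpace Ω] (μ : Measure Ω) (Q : ℕ → Ω → ℝ) : Prop :=
  (∀ t, Integrable (Q t) μ) ∧
    limsup (fun t : ℕ =>
      (((1 / (t : ℝ)) * ∑ τ ∈ Finset.Icc 1 t, ∫ ω, Q τ ω ∂μ : ℝ) : EReal)) atTop < ⊤

end

end MultiCell

/-! The proof is a drift-plus-penalty argument for the Lyapunov function `L(q) = ∑ q_k²`. One slot
raises `L` by at most `incr` (whose mean is `2κ`) plus twice the inner product of the queues with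
arrivals minus service rates. Optimality of the arrivals allows them to be replaced by any `x` of
the box with finite utility, at the price `V (U(A[t]) - U(x))`. The max-weight decision makes the
mean rates at least as good in direction `q` as every point of the region. What remains is a
mean-zero term, the noise. All this is packaged in `DriftModel`.

For (a), take `x = R*`: the terms linear in the queues cancel, and telescoping along the path bounds
the average utility of the arrivals below by `U(R*) - κ/V`, up to averaged noise and an initial term
of order `1/n`. Concavity passes to the utility of the average arrival, and average arrivals exceed
average rates by at most `Q[n+1]/n`. It remains that the averaged noise and `Q[n]/n` vanish almost
surely. The noise is a martingale difference whose variance is of order `E L(Q[t])`, so second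
moments of the queues are needed, and `L` alone only controls first moments. They come from the
drift of `L²` (`exists_quartic_drift`): a point of finite utility lying `δ` below the region
(`exists_slack`) gives `E L(q')² ≤ L(q)² + C - L(q)`, where `q'` is the next queue vector. Summed
against `1/(t+1)²` this shows `∑ E L(Q[t])/(t+1)² < ∞`, which yields `Q[n]/n → 0` and, through
martingale convergence and Kronecker's lemma, the law of large numbers for the noise. The unweighted
sum gives strong stability.

For (b), take `x = β R`: the drift keeps the term `-(1-β) ∑ R_k q_k`. After taking expectations, an
upper bound on the mean utility of the arrivals is needed. Mean arrivals lie in the box and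
asymptotically below points of the region, which is closed and downward closed, so Jensen's
inequality and compactness give `U(R*)`.

The link with the radio model is `AdaptivePolicy.max_weight`: interference is independent of the own
channels and seed, so weighted throughput is the mean of exactly the quantity that the policy
maximizes for almost every channel matrix. -/

namespace MultiCell

/-! ### Deterministic sequences: Kronecker's lemma, shifted averages, weighted telescoping. -/

section Sequences

/-- Kronecker's lemma for the weights `n + 1`. -/
theorem kronecker_cesaro {d : ℕ → ℝ} {l : ℝ}
    (h : Tendsto (fun n => ∑ i ∈ Finset.range n, d i / ((i : ℝ) + 1)) atTop (𝓝 l)) :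
    Tendsto (fun n : ℕ => (n : ℝ)⁻¹ * ∑ i ∈ Finset.range n, d i) atTop (𝓝 0) := by
  set s : ℕ → ℝ := fun n => ∑ i ∈ Finset.range n, d i / ((i : ℝ) + 1) with hs
  -- Summation by parts. After division by `n` both terms tend to `l`, the second one as a Cesàro
  -- mean.
  have key : ∀ n, ∑ i ∈ Finset.range n, d i = n * s n - ∑ i ∈ Finset.range n, s i := by
    intro n
    induction n with
    | zero => simp
    | succ n ih =>
      have hn : ((n : ℝ) + 1) ≠ 0 := by positivity
      have h1 : s (n + 1) = s n + d n / ((n : ℝ) + 1) := by simp [hs, Finset.sum_range_succ]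
      rw [Finset.sum_range_succ, ih, Finset.sum_range_succ, h1]
      push_cast
      field_simp
      ring
  have h2 := h.sub h.cesaro
  rw [sub_self] at h2
  refine h2.congr' ?_
  filter_upwards [eventually_gt_atTop 0] with n hn
  have hn' : (n : ℝ) ≠ 0 := by positivity
  rw [key, mul_sub, ← mul_assoc, inv_mul_cancel₀ hn', one_mul]

/-- The theorem averages over slots `1, …, n`, the laws of large numbers over `0, …, n - 1`. The
change costs a factor `(n + 1)/n` and the term `f 0 / n`. -/
theorem tendsto_average_Icc {f : ℕ → ℝ} {l : ℝ}
    (h : Tendsto (fun n : ℕ => (n : ℝ)⁻¹ * ∑ i ∈ Finset.range n, f i) atTop (𝓝 l)) :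
    Tendsto (fun n : ℕ => (1 / (n : ℝ)) * ∑ i ∈ Finset.Icc 1 n, f i) atTop (𝓝 l) := by
  have h1 : Tendsto (fun n : ℕ => ((n + 1 : ℕ) : ℝ) / (n : ℝ)) atTop (𝓝 1) := by
    have := tendsto_natCast_div_add_atTop (1 : ℝ)
    have h2 := this.inv₀ one_ne_zero
    simpa using h2
  have h3 : Tendsto (fun n : ℕ => (1 / (n : ℝ)) * f 0) atTop (𝓝 0) := by
    simpa using (tendsto_one_div_atTop_nhds_zero_nat (𝕜 := ℝ)).mul_const (f 0)
  have h4 := (h1.mul ((tendsto_add_atTop_iff_nat 1).2 h)).sub h3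
  simp only [one_mul, sub_zero] at h4
  refine h4.congr' ?_
  filter_upwards [eventually_gt_atTop 0] with n hn
  have hn' : (n : ℝ) ≠ 0 := by positivity
  have hn'' : ((n + 1 : ℕ) : ℝ) ≠ 0 := by positivity
  have : ∑ i ∈ Finset.range (n + 1), f i = f 0 + ∑ i ∈ Finset.Icc 1 n, f i := by
    rw [Finset.sum_range_succ', add_comm, Finset.range_eq_Ico,
      Finset.sum_Ico_add' (fun i => f i) 0 n 1]
    congr 1
  rw [this]
  field_simp
  ring

/-- Weighted sums of increments of a non-negative sequence stay bounded. -/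
theorem summable_weighted_of_drift {a b w : ℕ → ℝ} {c : ℝ} (ha : ∀ t, 0 ≤ a t) (hb : ∀ t, 0 ≤ b t)
    (hw : ∀ t, 0 ≤ w t) (hw_anti : Antitone w) (hw_sum : Summable w) (hc : 0 ≤ c)
    (h : ∀ t, a t ≤ b t - b (t + 1) + c) : Summable fun t => a t * w t := by
  have hb' : ∀ n, ∑ t ∈ Finset.range n, a t * w t
      ≤ b 0 * w 0 - b n * w n + c * ∑ t ∈ Finset.range n, w t := by
    intro n
    induction n with
    | zero => simp
    | succ n ih =>
      rw [Finset.sum_range_succ, Finset.sum_range_succ]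
      have h1 := mul_le_mul_of_nonneg_right (h n) (hw n)
      -- Because the weights decrease, replacing `w n` by `w (n + 1)` in front of `b (n + 1)` only
      -- helps, so the weighted differences still telescope.
      have h2 := mul_le_mul_of_nonneg_left (hw_anti (Nat.le_succ n)) (hb (n + 1))
      simp only [Nat.succ_eq_add_one] at h2
      nlinarith
  refine summable_of_sum_range_le (c := b 0 * w 0 + c * ∑' t, w t)
    (fun t => mul_nonneg (ha t) (hw t)) fun n => (hb' n).trans ?_
  have h3 := mul_le_mul_of_nonneg_left (hw_sum.sum_le_tsum (Finset.range n) fun i _ => hw i) hc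
  have h4 := mul_nonneg (hb n) (hw n)
  linarith

theorem summable_inv_succ_sq : Summable fun t : ℕ => (((t : ℝ) + 1) ^ 2)⁻¹ := by
  have := (summable_nat_add_iff 1).2 (Real.summable_nat_pow_inv (p := 2) |>.2 (by norm_num))
  simpa using this

theorem antitone_inv_succ_sq : Antitone fun t : ℕ => (((t : ℝ) + 1) ^ 2)⁻¹ := by
  intro s t hst
  have : (s : ℝ) ≤ t := by exact_mod_cast hst
  simp only
  gcongr

end Sequences

/-! ### A strong law for square-integrable martingale differences. -/

section Martingale

variable {Ω : Type*} {m0 : MeasurableSpace Ω} {μ : Measure Ω}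

theorem ae_summable_of_summable_integral {f : ℕ → Ω → ℝ} (hf : ∀ n, 0 ≤ f n)
    (hint : ∀ n, Integrable (f n) μ) (hs : Summable fun n => ∫ ω, f n ω ∂μ) :
    ∀ᵐ ω ∂μ, Summable fun n => f n ω := by
  have h1 : ∀ n, ∫⁻ ω, ENNReal.ofReal (f n ω) ∂μ = ENNReal.ofReal (∫ ω, f n ω ∂μ) := fun n =>
    (ofReal_integral_eq_lintegral_ofReal (hint n) (ae_of_all _ (hf n))).symm
  have hm : ∀ n, AEMeasurable (fun ω => ENNReal.ofReal (f n ω)) μ := fun n =>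
    (hint n).aemeasurable.ennreal_ofReal
  have h2 : ∫⁻ ω, ∑' n, ENNReal.ofReal (f n ω) ∂μ ≠ ∞ := by
    rw [lintegral_tsum hm]
    simp_rw [h1]
    exact hs.tsum_ofReal_ne_top
  filter_upwards [ae_lt_top' (AEMeasurable.tsum hm) h2] with ω hω
  have h3 := ENNReal.summable_toReal hω.ne
  refine h3.congr fun n => ?_
  rw [ENNReal.toReal_ofReal (hf n ω)]

/-- Strong law of large numbers for martingale differences. -/
theorem ae_tendsto_average_of_condExp_eq_zero [IsProbabilityMeasure μ] {ℱ : Filtration ℕ m0}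
    {d : ℕ → Ω → ℝ} (hd : ∀ t, StronglyMeasurable[ℱ (t + 1)] (d t))
    (hL2 : ∀ t, MemLp (d t) 2 μ) (hc : ∀ t, μ[d t | ℱ t] =ᵐ[μ] 0)
    (hs : Summable fun t : ℕ => (∫ ω, d t ω ^ 2 ∂μ) * (((t : ℝ) + 1) ^ 2)⁻¹) :
    ∀ᵐ ω ∂μ, Tendsto (fun n : ℕ => (n : ℝ)⁻¹ * ∑ i ∈ Finset.range n, d i ω) atTop (𝓝 0) := by
  set N : ℕ → Ω → ℝ := fun n ω => ∑ i ∈ Finset.range n, d i ω / ((i : ℝ) + 1) with hN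
  have hNsucc : ∀ n, N (n + 1) = fun ω => N n ω + d n ω / ((n : ℝ) + 1) := fun n => by
    ext ω; simp [hN, Finset.sum_range_succ]
  have hNmeas : ∀ n, StronglyMeasurable[ℱ n] (N n) := by
    intro n
    refine Finset.stronglyMeasurable_fun_sum _ fun i hi => ?_
    have h1 : StronglyMeasurable[ℱ n] (d i) := (hd i).mono (ℱ.mono (Finset.mem_range.1 hi))
    simpa only [div_eq_mul_inv] using
      StronglyMeasurable.mul_const h1 (((i : ℝ) + 1)⁻¹)
  have hNL2 : ∀ n, MemLp (N n) 2 μ := fun n =>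
    memLp_finsetSum _ fun i _ => by
      simpa only [div_eq_inv_mul] using (hL2 i).const_mul (((i : ℝ) + 1)⁻¹)
  have hNd : ∀ n, Integrable (fun ω => N n ω * d n ω) μ := fun n =>
    (hNL2 n).integrable_mul (hL2 n)
  -- `N n` is known at time `n` and can be pulled out of the conditional expectation. This
  -- orthogonality makes `E N²` the sum of the scaled variances, hence bounded.
  have horth : ∀ n, ∫ ω, N n ω * d n ω ∂μ = 0 := by
    intro n
    rw [← integral_condExp (ℱ.le n)]
    have h1 := condExp_mul_of_stronglyMeasurable_left (hNmeas n) (hNd n)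
      ((hL2 n).integrable (by norm_num))
    have h2 : μ[fun ω => N n ω * d n ω | ℱ n] =ᵐ[μ] 0 := by
      refine EventuallyEq.trans h1 ?_
      filter_upwards [hc n] with ω hω
      simp [hω]
    rw [integral_congr_ae h2]
    simp
  have hsq : ∀ n, ∫ ω, N n ω ^ 2 ∂μ =
      ∑ i ∈ Finset.range n, (∫ ω, d i ω ^ 2 ∂μ) * (((i : ℝ) + 1) ^ 2)⁻¹ := by
    intro n
    induction n with
    | zero => simp [hN]
    | succ n ih =>
      rw [Finset.sum_range_succ, ← ih, hNsucc]
      have : ∀ ω, (N n ω + d n ω / ((n : ℝ) + 1)) ^ 2 = N n ω ^ 2 +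
          (2 * ((n : ℝ) + 1)⁻¹) * (N n ω * d n ω) + d n ω ^ 2 * (((n : ℝ) + 1) ^ 2)⁻¹ := by
        intro ω; field_simp; ring
      simp_rw [this]
      have i1 := (hNL2 n).integrable_sq
      have i2 := (hNd n).const_mul (2 * ((n : ℝ) + 1)⁻¹)
      have i3 := (hL2 n).integrable_sq.mul_const (((n : ℝ) + 1) ^ 2)⁻¹
      rw [integral_add (f := fun ω => N n ω ^ 2 + _) (i1.add i2) i3, integral_add i1 i2,
        integral_const_mul, integral_mul_const, horth]
      ring
  have hmart : Martingale N ℱ μ := by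
    refine martingale_of_condExp_sub_eq_zero_nat (fun n => hNmeas n)
      (fun n => (hNL2 n).integrable (by norm_num)) fun n => ?_
    have : N (n + 1) - N n = ((n : ℝ) + 1)⁻¹ • d n := by
      ext ω; simp [hNsucc, div_eq_inv_mul]
    rw [this]
    refine (condExp_smul _ _ _).trans ?_
    filter_upwards [hc n] with ω hω
    simp [hω]
  -- Martingale convergence asks for an `L¹` bound, which follows from the `L²` bound by `|x| ≤ 1 +
  -- x²`.
  have hbdd : ∀ n, eLpNorm (N n) 1 μ ≤ ((Real.toNNReal
      (1 + ∑' t : ℕ, (∫ ω, d t ω ^ 2 ∂μ) * (((t : ℝ) + 1) ^ 2)⁻¹) : ℝ≥0) : ℝ≥0∞) := by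
    intro n
    have hi : Integrable (N n) μ := (hNL2 n).integrable (by norm_num)
    rw [eLpNorm_one_eq_lintegral_enorm, ← ofReal_integral_norm_eq_lintegral_enorm hi]
    refine ENNReal.ofReal_le_ofReal ?_
    calc ∫ ω, ‖N n ω‖ ∂μ ≤ ∫ ω, (1 + N n ω ^ 2) ∂μ := by
          refine integral_mono hi.norm ((integrable_const _).add (hNL2 n).integrable_sq) fun ω => ?_
          simp only [Real.norm_eq_abs]
          nlinarith [sq_nonneg (|N n ω| - 1), sq_abs (N n ω), abs_nonneg (N n ω)]
      _ = 1 + ∫ ω, N n ω ^ 2 ∂μ := by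
          rw [integral_add (integrable_const _) (hNL2 n).integrable_sq]; simp
      _ ≤ _ := by
          rw [hsq]
          gcongr
          exact hs.sum_le_tsum _ fun i _ =>
            mul_nonneg (integral_nonneg fun ω => sq_nonneg _) (by positivity)
  filter_upwards [hmart.submartingale.exists_ae_tendsto_of_bdd hbdd] with ω ⟨l, hl⟩
  exact kronecker_cesaro hl

end Martingale

/-! ### The history of independent slots, and integration over a fresh slot. -/

section Past

variable {Ω E : Type*} {m0 : MeasurableSpace Ω} [MeasurableSpace E] {μ : Measure Ω}
  {ν : Measure E} {W : ℕ → Ω → E}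

/-- The information available strictly before slot `t`. -/
def past (W : ℕ → Ω → E) (hW : ∀ t, Measurable (W t)) : Filtration ℕ m0 where
  seq t := ⨆ s ∈ Set.Iio t, MeasurableSpace.comap (W s) inferInstance
  mono' _ _ hst := biSup_mono fun _ hi => lt_of_lt_of_le hi hst
  le' _ := iSup₂_le fun s _ => (hW s).comap_le

theorem measurable_past_succ (hW : ∀ t, Measurable (W t)) (t : ℕ) :
    Measurable[past W hW (t + 1)] (W t) := by
  refine Measurable.mono (comap_measurable (W t)) ?_ le_rfl
  exact le_iSup₂ (f := fun s (_ : s ∈ Set.Iio (t + 1)) =>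
    MeasurableSpace.comap (W s) inferInstance) t (Nat.lt_succ_self t)

theorem map_past_prod [IsProbabilityMeasure μ] (hW : ∀ t, Measurable (W t))
    (hlaw : ∀ t, μ.map (W t) = ν) (hind : iIndepFun W μ) {α : Type*} [MeasurableSpace α] {t : ℕ}
    {X : Ω → α} (hX : Measurable[past W hW t] X) :
    μ.map (fun ω => (X ω, W t ω)) = (μ.map X).prod ν := by
  have hX' : Measurable X := hX.mono ((past W hW).le t) le_rfl
  have h1 : Indep (past W hW t) (MeasurableSpace.comap (W t) inferInstance) μ := by
    have := indep_iSup_of_disjoint (fun s => (hW s).comap_le) hind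
      (S := Set.Iio t) (T := {t}) (by simp)
    simp only [Set.mem_singleton_iff, iSup_iSup_eq_left] at this
    exact this
  have h2 : X ⟂ᵢ[μ] W t := by
    rw [IndepFun_iff_Indep]
    exact indep_of_indep_of_le_left h1 hX.comap_le
  rw [← hlaw t]
  exact (indepFun_iff_map_prod_eq_prod_map_map hX'.aemeasurable (hW t).aemeasurable).1 h2

/-- A variable determined by the past is independent of the current slot, so their joint law is a
product and Fubini averages the slot out first. This replaces conditioning on the queue state. -/
theorem integral_past [IsProbabilityMeasure μ] (hW : ∀ t, Measurable (W t))
    (hlaw : ∀ t, μ.map (W t) = ν) (hind : iIndepFun W μ) {α : Type*} [MeasurableSpace α] {t : ℕ}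
    {X : Ω → α} (hX : Measurable[past W hW t] X) {G : α × E → ℝ} (hG : Measurable G)
    (hint : Integrable (fun ω => G (X ω, W t ω)) μ) :
    Integrable (fun ω => ∫ w, G (X ω, w) ∂ν) μ ∧
      ∫ ω, G (X ω, W t ω) ∂μ = ∫ ω, ∫ w, G (X ω, w) ∂ν ∂μ := by
  have hX' : Measurable X := hX.mono ((past W hW).le t) le_rfl
  have hν : IsProbabilityMeasure ν := hlaw t ▸ Measure.isProbabilityMeasure_map (hW t).aemeasurable
  have := Measure.isProbabilityMeasure_map (μ := μ) hX'.aemeasurable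
  have hm := map_past_prod hW hlaw hind hX
  have hXW : Measurable fun ω => (X ω, W t ω) := hX'.prodMk (hW t)
  have h1 : Integrable G ((μ.map X).prod ν) := by
    rw [← hm]
    exact (integrable_map_measure hG.aestronglyMeasurable hXW.aemeasurable).2 hint
  have h2 := h1.integral_prod_left
  refine ⟨(integrable_map_measure h2.aestronglyMeasurable hX'.aemeasurable).1 h2, ?_⟩
  rw [← integral_map (φ := fun ω => (X ω, W t ω)) hXW.aemeasurable hG.aestronglyMeasurable, hm,
    integral_prod _ h1, integral_map hX'.aemeasurable h2.aestronglyMeasurable]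

theorem condExp_past_eq_zero [IsProbabilityMeasure μ] (hW : ∀ t, Measurable (W t))
    (hlaw : ∀ t, μ.map (W t) = ν) (hind : iIndepFun W μ) {α : Type*} [MeasurableSpace α] {t : ℕ}
    {X : Ω → α} (hX : Measurable[past W hW t] X) {G : α × E → ℝ} (hG : Measurable G)
    (hint : Integrable (fun ω => G (X ω, W t ω)) μ) (h0 : ∀ ω, ∫ w, G (X ω, w) ∂ν = 0) :
    μ[fun ω => G (X ω, W t ω) | past W hW t] =ᵐ[μ] 0 := by
  symm
  refine ae_eq_condExp_of_forall_setIntegral_eq ((past W hW).le t) hint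
    (fun s _ _ => integrableOn_zero) (fun s hs _ => ?_) aestronglyMeasurable_const
  have hs' : MeasurableSet s := (past W hW).le t s hs
  -- The indicator of the past event `s` is itself past information. Paired with `X`, it reduces the
  -- integral over `s` to `integral_past`.
  have hY : Measurable[past W hW t] (fun ω => (s.indicator (fun _ => (1 : ℝ)) ω, X ω)) :=
    Measurable.prodMk (measurable_const.indicator hs) hX
  have hG' : Measurable (fun p : (ℝ × α) × E => p.1.1 * G (p.1.2, p.2)) := by fun_prop
  have heq : (fun ω => s.indicator (fun _ => (1 : ℝ)) ω * G (X ω, W t ω)) =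
      s.indicator (fun ω => G (X ω, W t ω)) := by
    ext ω; by_cases h : ω ∈ s <;> simp [h]
  have h1 := (integral_past hW hlaw hind hY hG' (by
    simpa only [heq] using hint.indicator hs')).2
  simp only [heq, integral_const_mul, h0, mul_zero, integral_zero] at h1
  rw [← integral_indicator (f := fun ω => G (X ω, W t ω)) hs', h1]
  simp

end Past

/-! ### Extended-real-valued concave utilities. -/

section Utility

variable {K : ℕ} {U : (Fin K → ℝ) → EReal}

/-- The real hypograph of a utility function on the non-negative orthant. -/
def hypograph (U : (Fin K → ℝ) → EReal) : Set ((Fin K → ℝ) × ℝ) :=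
  {p | p ∈ {p : (Fin K → ℝ) × ℝ | 0 ≤ p.1} ∧ (p.2 : EReal) ≤ U p.1}

/-- Together with convexity this turns Jensen's inequality for expectations into membership of a
mean in a closed convex set, so no integral of a function with value `⊥` is needed. -/
theorem isClosed_hypograph (hU : ContinuousOn U (Set.Ici 0)) : IsClosed (hypograph U) := by
  have h : IsClosed {p : (Fin K → ℝ) × ℝ | 0 ≤ p.1} := isClosed_le continuous_const continuous_fst
  exact h.isClosed_le (continuous_coe_real_ereal.comp continuous_snd).continuousOn
    (hU.comp continuous_fst.continuousOn fun p hp => hp)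

theorem convex_hypograph (hU : ConcaveOnOrthant U) : Convex ℝ (hypograph U) := by
  rintro ⟨x, s⟩ ⟨hx, hs⟩ ⟨y, t⟩ ⟨hy, ht⟩ a b ha hb hab
  simp only [Set.mem_ofPred_eq] at hx hy hs ht
  refine ⟨add_nonneg (smul_nonneg ha hx) (smul_nonneg hb hy), le_trans ?_
        (hU x y hx hy a b ha hb hab)⟩
  simp only [Prod.smul_mk, Prod.mk_add_mk, smul_eq_mul, EReal.coe_add, EReal.coe_mul]
  exact add_le_add (mul_le_mul_of_nonneg_left hs (by exact_mod_cast ha))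
    (mul_le_mul_of_nonneg_left ht (by exact_mod_cast hb))

theorem isCompact_box (K : ℕ) (A : ℝ) : IsCompact (box K A) := by
  have : box K A = Set.Icc 0 (fun _ => A) := by
    ext x; simp [box, Set.mem_Icc, Pi.le_def, forall_and]
  rw [this]; exact isCompact_Icc

theorem convex_box (K : ℕ) (A : ℝ) : Convex ℝ (box K A) := by
  have : box K A = Set.Icc 0 (fun _ => A) := by
    ext x; simp [box, Set.mem_Icc, Pi.le_def, forall_and]
  rw [this]; exact convex_Icc _ _

theorem nonneg_of_mem_box {A : ℝ} {x : Fin K → ℝ} (hx : x ∈ box K A) : 0 ≤ x := fun k => (hx k).1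

theorem exists_bound_on_box (hU : ContinuousOn U (Set.Ici 0)) (hU_top : ∀ x, 0 ≤ x → U x ≠ ⊤)
    {A : ℝ} (hA : 0 ≤ A) : ∃ m : ℝ, ∀ x ∈ box K A, U x ≤ m := by
  obtain ⟨y, hy, hmax⟩ := (isCompact_box K A).exists_isMaxOn ⟨0, fun k => ⟨le_rfl, hA⟩⟩
    (hU.mono fun x hx => nonneg_of_mem_box hx)
  refine ⟨(U y).toReal, fun x hx => (hmax hx).trans
        (EReal.le_coe_toReal (hU_top y (nonneg_of_mem_box hy)))⟩

/-- If `z n` is asymptotically below the bounded sequence `x n`, the utility of `x n` is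
asymptotically at least that of `z n`. -/
theorem eventually_lt_utility (hU : ContinuousOn U (Set.Ici 0)) (hmono : MonotoneOn U (Set.Ici 0))
    {x z : ℕ → Fin K → ℝ} {ε : ℕ → Fin K → ℝ} {v : ℕ → EReal} {l y : EReal}
    (hx : ∀ n, 0 ≤ x n) (hz : ∀ n, 0 ≤ z n) (hε : ∀ n, 0 ≤ ε n)
    (hbdd : Bornology.IsBounded (Set.range x)) (hε0 : Tendsto ε atTop (𝓝 0))
    (hle : ∀ᶠ n in atTop, z n ≤ x n + ε n) (hv : ∀ᶠ n in atTop, v n ≤ U (z n))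
    (hvl : Tendsto v atTop (𝓝 l)) (hy : y < l) : ∀ᶠ n in atTop, y < U (x n) := by
  -- Differences of utilities are not controlled near `⊥`, so the argument is by compactness: along
  -- a subsequence `x n` and `x n + ε n` have a common limit `ρ`, and continuity there forces `l ≤ U
  -- ρ ≤ y`.
  by_contra hcon
  have hfreq : ∃ᶠ n in atTop, U (x n) ≤ y ∧ v n ≤ U (x n + ε n) := by
    have h1 : ∃ᶠ n in atTop, U (x n) ≤ y := by simpa [Filter.Frequently] using hcon
    refine (h1.and_eventually (hle.and hv)).mono ?_
    rintro n ⟨h2, h3, h4⟩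
    exact ⟨h2, h4.trans (hmono (hz n) (add_nonneg (hx n) (hε n)) h3)⟩
  obtain ⟨φ, hφ, hP⟩ := extraction_of_frequently_atTop hfreq
  obtain ⟨ρ, -, ψ, hψ, hρ⟩ := tendsto_subseq_of_bounded hbdd (x := x ∘ φ) fun n => ⟨φ n, rfl⟩
  have hsub : Tendsto (φ ∘ ψ) atTop atTop := hφ.tendsto_atTop.comp hψ.tendsto_atTop
  have hρ0 : 0 ≤ ρ := ge_of_tendsto' hρ fun n => hx _
  have hρ' : Tendsto (fun n => x (φ (ψ n)) + ε (φ (ψ n))) atTop (𝓝 ρ) := by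
    simpa using hρ.add (hε0.comp hsub)
  have h1 : Tendsto (fun n => U (x (φ (ψ n)))) atTop (𝓝 (U ρ)) :=
    (hU ρ hρ0).tendsto.comp (tendsto_nhdsWithin_iff.2 ⟨hρ, Eventually.of_forall fun n => hx _⟩)
  have h2 : Tendsto (fun n => U (x (φ (ψ n)) + ε (φ (ψ n)))) atTop (𝓝 (U ρ)) :=
    (hU ρ hρ0).tendsto.comp (tendsto_nhdsWithin_iff.2
      ⟨hρ', Eventually.of_forall fun n => add_nonneg (hx _) (hε _)⟩)
  have h3 : U ρ ≤ y := le_of_tendsto' h1 fun n => (hP (ψ n)).1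
  have h4 : l ≤ U ρ := le_of_tendsto_of_tendsto' (hvl.comp hsub) h2 fun n => (hP (ψ n)).2
  exact absurd (h4.trans h3) (not_le.2 hy)

/-- A sequence of the box that is asymptotically below elements of a closed lower set has
asymptotically at most the optimal utility of that set. -/
theorem eventually_utility_lt (hU : ContinuousOn U (Set.Ici 0)) {A : ℝ} {S : Set (Fin K → ℝ)}
    (hS : IsClosed S) (hlower : ∀ z ∈ S, ∀ x, 0 ≤ x → x ≤ z → x ∈ S)
    (hS0 : ∀ z ∈ S, 0 ≤ z) {l y : EReal} (hl : ∀ x ∈ S ∩ box K A, U x ≤ l)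
    {a b ε : ℕ → Fin K → ℝ} (ha : ∀ᶠ n in atTop, a n ∈ box K A) (hb : ∀ᶠ n in atTop, b n ∈ S)
    (hε0 : Tendsto ε atTop (𝓝 0)) (hle : ∀ᶠ n in atTop, a n ≤ b n + ε n) (hy : l < y) :
    ∀ᶠ n in atTop, U (a n) < y := by
  by_contra hcon
  have hfreq : ∃ᶠ n in atTop, y ≤ U (a n) ∧ a n ∈ box K A ∧ b n ∈ S ∧ a n ≤ b n + ε n := by
    have h1 : ∃ᶠ n in atTop, y ≤ U (a n) := by simpa [Filter.Frequently] using hcon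
    exact h1.and_eventually (ha.and (hb.and hle))
  obtain ⟨φ, hφ, hP⟩ := extraction_of_frequently_atTop hfreq
  obtain ⟨ρ, hρbox, ψ, hψ, hρ⟩ := (isCompact_box K A).tendsto_subseq
        (x := a ∘ φ) fun n => (hP n).2.1
  have hsub : Tendsto (φ ∘ ψ) atTop atTop := hφ.tendsto_atTop.comp hψ.tendsto_atTop
  -- Subtracting `ε` moves `a` below a point of `S`, and truncation at `0` returns it to the
  -- orthant; so these points lie in `S` and carry the limit `ρ` into it.
  have hc : Tendsto (fun n => (a (φ (ψ n)) - ε (φ (ψ n))) ⊔ 0) atTop (𝓝 (ρ ⊔ 0)) := by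
    have := hρ.sub (hε0.comp hsub)
    rw [sub_zero] at this
    have hsup : Continuous fun x : Fin K → ℝ => x ⊔ 0 :=
      continuous_pi fun k => (continuous_apply k).max continuous_const
    exact (hsup.tendsto ρ).comp this
  rw [sup_eq_left.2 (nonneg_of_mem_box hρbox)] at hc
  have hρS : ρ ∈ S := hS.mem_of_tendsto hc (Eventually.of_forall fun n => by
    obtain ⟨-, -, h3, h4⟩ := hP (ψ n)
    exact hlower _ h3 _ le_sup_right (sup_le (sub_le_iff_le_add.2 h4) (hS0 _ h3)))
  have h1 : Tendsto (fun n => U (a (φ (ψ n)))) atTop (𝓝 (U ρ)) :=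
    (hU ρ (nonneg_of_mem_box hρbox)).tendsto.comp (tendsto_nhdsWithin_iff.2
      ⟨hρ, Eventually.of_forall fun n => nonneg_of_mem_box (hP (ψ n)).2.1⟩)
  have h2 : y ≤ U ρ := ge_of_tendsto' h1 fun n => (hP (ψ n)).1
  exact absurd (h2.trans (hl ρ ⟨hρS, hρbox⟩)) (not_le.2 hy)

/-- A short move from `Rs` towards `r / 2` keeps the utility finite by continuity, while the same
move towards `r` stays in `S` and lies higher by `ε r / 2`. The cap at `A` keeps the first point in
the box and only lowers it. -/
theorem exists_slack (hU : ContinuousOn U (Set.Ici 0)) {A : ℝ} {S : Set (Fin K → ℝ)}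
    (hA : 0 < A) (hS : Convex ℝ S) {r Rs : Fin K → ℝ} (hr : r ∈ S) (hr0 : ∀ k, 0 < r k)
    (hRs : Rs ∈ S ∩ box K A) (hURs : U Rs ≠ ⊥) :
    ∃ x ∈ box K A, U x ≠ ⊥ ∧ ∃ δ > 0, ∃ z ∈ S, ∀ k, x k + δ ≤ z k := by
  set x : ℝ → Fin K → ℝ := fun ε k => min ((1 - ε) * Rs k + ε * (r k / 2)) A with hx
  have hcont : Continuous x := by fun_prop
  have hx0 : x 0 = Rs := by ext k; simp [hx, (hRs.2 k).2]
  have hxbox : ∀ ε, 0 ≤ ε → ε ≤ 1 → x ε ∈ box K A := fun ε h0 h1 k =>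
    ⟨le_min (add_nonneg (mul_nonneg (by linarith) (hRs.2 k).1)
      (mul_nonneg h0 (by linarith [hr0 k]))) hA.le, min_le_right _ _⟩
  have hlim : Tendsto (fun ε => U (x ε)) (𝓝[Set.Icc 0 1] 0) (𝓝 (U Rs)) := by
    have h1 := (hU (x 0) (hx0 ▸ nonneg_of_mem_box hRs.2)).tendsto
    rw [hx0] at h1
    refine h1.comp (tendsto_nhdsWithin_iff.2 ⟨?_, ?_⟩)
    · have := hcont.tendsto 0
      rw [hx0] at this
      exact this.mono_left nhdsWithin_le_nhds
    · filter_upwards [self_mem_nhdsWithin] with ε hε using nonneg_of_mem_box (hxbox ε hε.1 hε.2)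
  have hev : ∀ᶠ ε in 𝓝[Set.Icc (0 : ℝ) 1] 0, U (x ε) ≠ ⊥ := by
    filter_upwards [hlim.eventually (lt_mem_nhds (bot_lt_iff_ne_bot.2 hURs))] with ε hε using hε.ne'
  have hev' : ∀ᶠ ε in 𝓝[>] (0 : ℝ), U (x ε) ≠ ⊥ := by
    have : 𝓝[>] (0 : ℝ) ≤ 𝓝[Set.Icc (0 : ℝ) 1] 0 := by
      refine le_inf inf_le_left ?_
      rw [le_principal_iff]
      filter_upwards [Ioc_mem_nhdsGT (zero_lt_one' ℝ)] with ε hε using ⟨hε.1.le, hε.2⟩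
    exact hev.filter_mono this
  obtain ⟨ε, hεU, hε⟩ := (hev'.and (Ioc_mem_nhdsGT (zero_lt_one' ℝ))).exists
  obtain ⟨m, hm, hmr⟩ : ∃ m > 0, ∀ k, m ≤ r k := by
    by_cases hK : Nonempty (Fin K)
    · obtain ⟨k, -, hk⟩ := Finset.exists_min_image Finset.univ r
        ⟨Classical.arbitrary _, Finset.mem_univ _⟩
      exact ⟨r k, hr0 k, fun j => hk j (Finset.mem_univ _)⟩
    · exact ⟨1, one_pos, fun k => (hK ⟨k⟩).elim⟩
  refine ⟨x ε, hxbox ε hε.1.le hε.2, hεU, ε * (m / 2), mul_pos hε.1 (by linarith),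
    (1 - ε) • Rs + ε • r, hS hRs.1 hr (by linarith [hε.2]) hε.1.le (by ring), fun k => ?_⟩
  have h1 : x ε k ≤ (1 - ε) * Rs k + ε * (r k / 2) := min_le_left _ _
  have h2 := mul_le_mul_of_nonneg_left (hmr k) hε.1.le
  simp only [Pi.add_apply, Pi.smul_apply, smul_eq_mul]
  linarith

end Utility

/-! ### The abstract queueing network and its one-step drift. -/

/-- A controlled network of `K` virtual queues driven by i.i.d. slots: the arrivals maximize
`V U(x) - ∑ₖ xₖ qₖ`, and the mean service rates maximize the weighted sum over a closed convex
region. -/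
structure DriftModel (K : ℕ) (E : Type*) [MeasurableSpace E] where
  law : Measure E
  isProb : IsProbabilityMeasure law
  rate : (Fin K → ℝ) → E → Fin K → ℝ
  arrival : (Fin K → ℝ) → Fin K → ℝ
  bnd : E → Fin K → ℝ
  region : Set (Fin K → ℝ)
  U : (Fin K → ℝ) → EReal
  V : ℝ
  A : ℝ
  measurable_rate : Measurable fun p : (Fin K → ℝ) × E => rate p.1 p.2
  measurable_arrival : Measurable arrival
  measurable_bnd : Measurable bnd
  rate_nonneg : ∀ q w k, 0 ≤ rate q w k
  rate_le : ∀ q w k, rate q w k ≤ bnd w k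
  bnd_pow_four : ∀ k, Integrable (fun w => bnd w k ^ 4) law
  V_pos : 0 < V
  A_pos : 0 < A
  U_ne_top : ∀ x, 0 ≤ x → U x ≠ ⊤
  U_cont : ContinuousOn U (Set.Ici 0)
  U_conc : ConcaveOnOrthant U
  U_mono : MonotoneOn U (Set.Ici 0)
  region_closed : IsClosed region
  region_convex : Convex ℝ region
  region_nonneg : ∀ z ∈ region, 0 ≤ z
  region_lower : ∀ z ∈ region, ∀ x, 0 ≤ x → x ≤ z → x ∈ region
  arrival_mem : ∀ q, arrival q ∈ box K A
  arrival_optimal : ∀ q, 0 ≤ q → ∀ x ∈ box K A,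
    (V : EReal) * U x - ((∑ k, x k * q k : ℝ) : EReal) ≤
      (V : EReal) * U (arrival q) - ((∑ k, arrival q k * q k : ℝ) : EReal)
  max_weight : ∀ q, 0 ≤ q → ∀ R ∈ region,
    ∑ k, q k * R k ≤ ∑ k, q k * ∫ w, rate q w k ∂law
  mean_rate_mem : ∀ q, (fun k => ∫ w, rate q w k ∂law) ∈ region

namespace DriftModel

variable {K : ℕ} {E : Type*} [MeasurableSpace E] (M : DriftModel K E)

instance : IsProbabilityMeasure M.law := M.isProb

/-- One step of the queue recursion. -/
noncomputable def step (q : Fin K → ℝ) (w : E) : Fin K → ℝ :=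
  fun k => max 0 (q k - M.rate q w k) + M.arrival q k

/-- The virtual queues along a sequence of slots. -/
noncomputable def queue (q₀ : Fin K → ℝ) (w : ℕ → E) : ℕ → Fin K → ℝ
  | 0 => q₀
  | t + 1 => M.step (queue q₀ w t) (w t)

/-- The mean service rate for given queues. -/
noncomputable def meanRate (q : Fin K → ℝ) (k : Fin K) : ℝ := ∫ w, M.rate q w k ∂M.law

/-- The bound on the squared increments. -/
noncomputable def incr (w : E) : ℝ := (K : ℝ) * M.A ^ 2 + ∑ k, M.bnd w k ^ 2

/-- The martingale part of the drift. -/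
noncomputable def noise (q : Fin K → ℝ) (w : E) : ℝ := ∑ k, q k * (M.meanRate q k - M.rate q w k)

/-- The real-valued utility of the arrivals. -/
noncomputable def util (q : Fin K → ℝ) : ℝ := (M.U (M.arrival q)).toReal

theorem measurable_rate_apply (k : Fin K) :
    Measurable fun p : (Fin K → ℝ) × E => M.rate p.1 p.2 k :=
  (measurable_pi_apply k).comp M.measurable_rate

theorem measurable_step : Measurable fun p : (Fin K → ℝ) × E => M.step p.1 p.2 := by
  refine measurable_pi_lambda _ fun k => ?_
  have h1 := M.measurable_rate_apply k
  have h2 : Measurable fun q => M.arrival q k := (measurable_pi_apply k).comp M.measurable_arrival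
  unfold step
  fun_prop

theorem measurable_meanRate : Measurable M.meanRate := by
  refine measurable_pi_lambda _ fun k => ?_
  exact (M.measurable_rate_apply k).stronglyMeasurable.integral_prod_right'.measurable

theorem measurable_bnd_apply (k : Fin K) : Measurable fun w => M.bnd w k :=
  (measurable_pi_apply k).comp M.measurable_bnd

theorem measurable_incr : Measurable M.incr := by
  have := M.measurable_bnd_apply
  unfold incr
  fun_prop

theorem measurable_noise : Measurable fun p : (Fin K → ℝ) × E => M.noise p.1 p.2 := by
  have h1 := M.measurable_rate_apply
  have h2 : ∀ k, Measurable fun q => M.meanRate q k := fun k =>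
    (measurable_pi_apply k).comp M.measurable_meanRate
  unfold noise
  fun_prop

/-- Continuity of `U` is available on the orthant only, so measurability is obtained on that
subtype, where the arrivals live. -/
theorem measurable_util : Measurable M.util := by
  have h1 : Continuous ((Set.Ici (0 : Fin K → ℝ)).domRestrict M.U) :=
    continuousOn_iff_continuous_domRestrict.1 M.U_cont
  have h2 : Measurable fun q => (⟨M.arrival q, nonneg_of_mem_box (M.arrival_mem q)⟩ :
      Set.Ici (0 : Fin K → ℝ)) := M.measurable_arrival.subtype_mk
  exact (h1.measurable.comp h2).ereal_toReal

theorem memLp_bnd_sq (k : Fin K) : MemLp (fun w => M.bnd w k ^ 2) 2 M.law := by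
  refine (memLp_two_iff_integrable_sq ?_).2 ?_
  · exact ((M.measurable_bnd_apply k).pow_const 2).aestronglyMeasurable
  · simpa only [← pow_mul] using M.bnd_pow_four k

theorem memLp_incr : MemLp M.incr 2 M.law :=
  (memLp_const ((K : ℝ) * M.A ^ 2)).add
    (memLp_finsetSum Finset.univ fun k _ => M.memLp_bnd_sq k)

theorem integrable_incr : Integrable M.incr M.law := M.memLp_incr.integrable (by norm_num)

theorem memLp_bnd (k : Fin K) : MemLp (fun w => M.bnd w k) 2 M.law :=
  (memLp_two_iff_integrable_sq (M.measurable_bnd_apply k).aestronglyMeasurable).2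
    ((M.memLp_bnd_sq k).integrable (by norm_num))

theorem integrable_bnd (k : Fin K) : Integrable (fun w => M.bnd w k) M.law :=
  (M.memLp_bnd k).integrable (by norm_num)

theorem integrable_rate (q : Fin K → ℝ) (k : Fin K) :
    Integrable (fun w => M.rate q w k) M.law :=
  (M.integrable_bnd k).mono'
    (((M.measurable_rate_apply k).comp measurable_prodMk_left).aestronglyMeasurable)
    (ae_of_all _ fun w => by
      rw [Real.norm_of_nonneg (M.rate_nonneg q w k)]; exact M.rate_le q w k)

theorem meanRate_nonneg (q : Fin K → ℝ) (k : Fin K) : 0 ≤ M.meanRate q k :=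
  integral_nonneg fun w => M.rate_nonneg q w k

theorem meanRate_le (q : Fin K → ℝ) (k : Fin K) : M.meanRate q k ≤ ∫ w, M.bnd w k ∂M.law :=
  integral_mono (M.integrable_rate q k) (M.integrable_bnd k) fun w => M.rate_le q w k

theorem integral_noise (q : Fin K → ℝ) : ∫ w, M.noise q w ∂M.law = 0 := by
  unfold noise
  have hint : ∀ k, Integrable (fun w => q k * (M.meanRate q k - M.rate q w k)) M.law := fun k =>
    ((integrable_const _).sub (M.integrable_rate q k)).const_mul _
  rw [integral_finsetSum _ fun k _ => hint k]
  refine Finset.sum_eq_zero fun k _ => ?_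
  rw [integral_const_mul, integral_sub (integrable_const _) (M.integrable_rate q k)]
  simp [meanRate]

theorem step_nonneg {q : Fin K → ℝ} (w : E) : 0 ≤ M.step q w := fun k =>
  add_nonneg (le_max_left _ _) (M.arrival_mem q k).1

theorem step_le {q : Fin K → ℝ} (hq : 0 ≤ q) (w : E) (k : Fin K) : M.step q w k ≤ q k + M.A := by
  have h1 := M.rate_nonneg q w k
  exact add_le_add (max_le (hq k) (by linarith)) (M.arrival_mem q k).2

/-- The reason is `max 0 (q - R) ^ 2 ≤ (q - R) ^ 2` together with `max 0 (q - R) ≤ q` in the cross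
term with the arrival. The squares of arrival and rate go into `incr`. -/
theorem sum_sq_step_le {q : Fin K → ℝ} (hq : 0 ≤ q) (w : E) :
    ∑ k, M.step q w k ^ 2 ≤ ∑ k, q k ^ 2 + M.incr w +
      2 * (∑ k, M.arrival q k * q k - ∑ k, q k * M.rate q w k) := by
  have h : ∀ k, M.step q w k ^ 2 ≤ q k ^ 2 + (M.A ^ 2 + M.bnd w k ^ 2) +
      2 * (M.arrival q k * q k - q k * M.rate q w k) := by
    intro k
    have h1 := M.rate_nonneg q w k
    have h2 := M.rate_le q w k
    obtain ⟨h3, h4⟩ := M.arrival_mem q k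
    have h5 : 0 ≤ q k := hq k
    have h6 : M.rate q w k ^ 2 ≤ M.bnd w k ^ 2 := by gcongr
    have h7 : M.arrival q k ^ 2 ≤ M.A ^ 2 := by gcongr
    unfold step
    rcases le_total 0 (q k - M.rate q w k) with h8 | h8
    · rw [max_eq_right h8]; nlinarith [mul_nonneg h3 h1]
    · rw [max_eq_left h8]; nlinarith [sq_nonneg (q k - M.rate q w k), mul_nonneg h3 h5]
  refine (Finset.sum_le_sum fun k _ => h k).trans (le_of_eq ?_)
  simp only [Finset.sum_add_distrib, ← Finset.mul_sum, Finset.sum_sub_distrib, incr,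
    Finset.sum_const, Finset.card_univ, Fintype.card_fin, nsmul_eq_mul]

/-- A competitor `x` of finite utility makes the left side of the optimality inequality real, which
rules out the value `⊥` for the arrivals; the inequality then descends to real numbers. -/
theorem util_spec {q x : Fin K → ℝ} (hq : 0 ≤ q) (hx : x ∈ box K M.A) (hUx : M.U x ≠ ⊥) :
    (M.util q : EReal) = M.U (M.arrival q) ∧
      ∑ k, M.arrival q k * q k ≤
        ∑ k, x k * q k + M.V * M.util q - M.V * (M.U x).toReal := by
  have h := M.arrival_optimal q hq x hx
  have hx' : M.U x = ((M.U x).toReal : EReal) :=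
    (EReal.coe_toReal (M.U_ne_top x (nonneg_of_mem_box hx)) hUx).symm
  have hbot : M.U (M.arrival q) ≠ ⊥ := by
    intro hb
    rw [hb, EReal.coe_mul_bot_of_pos M.V_pos, EReal.bot_sub, hx', ← EReal.coe_mul,
      ← EReal.coe_sub, le_bot_iff] at h
    exact EReal.coe_ne_bot _ h
  have ha : (M.util q : EReal) = M.U (M.arrival q) :=
    EReal.coe_toReal (M.U_ne_top _ (nonneg_of_mem_box (M.arrival_mem q))) hbot
  refine ⟨ha, ?_⟩
  rw [← ha, hx', ← EReal.coe_mul, ← EReal.coe_sub, ← EReal.coe_mul, ← EReal.coe_sub,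
    EReal.coe_le_coe_iff] at h
  linarith

/-- The drift inequality: `x` need not be achievable. -/
theorem drift_le {q x : Fin K → ℝ} (hq : 0 ≤ q) (hx : x ∈ box K M.A) (hUx : M.U x ≠ ⊥) (w : E) :
    ∑ k, M.step q w k ^ 2 ≤ ∑ k, q k ^ 2 + M.incr w +
      2 * (∑ k, x k * q k - ∑ k, q k * M.meanRate q k + M.V * M.util q
        - M.V * (M.U x).toReal + M.noise q w) := by
  have h1 := M.sum_sq_step_le hq w
  have h2 := (M.util_spec hq hx hUx).2
  have h3 : M.noise q w = ∑ k, q k * M.meanRate q k - ∑ k, q k * M.rate q w k := by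
    simp only [noise, mul_sub, Finset.sum_sub_distrib]
  linarith

/-- Cauchy–Schwarz separates the queues from the slot: second moments of the queues control the
variance of the noise. -/
theorem noise_sq_le (q : Fin K → ℝ) (w : E) :
    M.noise q w ^ 2 ≤ (∑ k, q k ^ 2) *
      ∑ k, ((∫ w, M.bnd w k ∂M.law) ^ 2 + M.bnd w k ^ 2) := by
  refine (Finset.sum_mul_sq_le_sq_mul_sq _ _ _).trans
    (mul_le_mul_of_nonneg_left (Finset.sum_le_sum fun k _ => ?_)
      (Finset.sum_nonneg fun k _ => sq_nonneg _))
  have h1 := M.meanRate_nonneg q k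
  have h2 := M.rate_nonneg q w k
  have h3 : M.meanRate q k ^ 2 ≤ (∫ w, M.bnd w k ∂M.law) ^ 2 :=
    pow_le_pow_left₀ h1 (M.meanRate_le q k) 2
  have h4 : M.rate q w k ^ 2 ≤ M.bnd w k ^ 2 := pow_le_pow_left₀ h2 (M.rate_le q w k) 2
  nlinarith [mul_nonneg h1 h2]

theorem queue_nonneg {q₀ : Fin K → ℝ} (hq₀ : 0 ≤ q₀) (w : ℕ → E) : ∀ t, 0 ≤ M.queue q₀ w t
  | 0 => hq₀
  | _ + 1 => M.step_nonneg _

theorem queue_le {q₀ : Fin K → ℝ} (hq₀ : 0 ≤ q₀) (w : ℕ → E) (t : ℕ) (k : Fin K) :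
    M.queue q₀ w t k ≤ q₀ k + t * M.A := by
  induction t with
  | zero => simp [queue]
  | succ t ih =>
    have := M.step_le (M.queue_nonneg hq₀ w t) (w t) k
    simp only [queue]
    push_cast
    linarith

theorem integrable_noise (q : Fin K → ℝ) : Integrable (M.noise q) M.law := by
  unfold noise
  exact integrable_finsetSum _ fun k _ =>
    ((integrable_const _).sub (M.integrable_rate q k)).const_mul _

/-- The square of the quadratic Lyapunov function has negative drift. -/
theorem exists_quartic_drift {x z : Fin K → ℝ} {δ : ℝ} (hx : x ∈ box K M.A) (hUx : M.U x ≠ ⊥)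
    (hδ : 0 < δ) (hz : z ∈ M.region) (hxz : ∀ k, x k + δ ≤ z k) :
    ∃ C : ℝ, 0 ≤ C ∧ ∀ q, 0 ≤ q →
      ∫ w, (∑ k, M.step q w k ^ 2) ^ 2 ∂M.law ≤ (∑ k, q k ^ 2) ^ 2 + C - ∑ k, q k ^ 2 := by
  obtain ⟨m, hm⟩ := exists_bound_on_box M.U_cont M.U_ne_top M.A_pos.le
  set b := ∫ w, M.incr w ∂M.law with hb
  set b₂ := ∫ w, M.incr w ^ 2 ∂M.law with hb₂
  have hincr : ∀ w, 0 ≤ M.incr w := fun w => by unfold incr; positivity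
  have hb0 : 0 ≤ b := integral_nonneg hincr
  have hb₂0 : 0 ≤ b₂ := integral_nonneg fun w => sq_nonneg _
  set c₀ := M.V * m - M.V * (M.U x).toReal with hc₀
  have hc₀0 : 0 ≤ c₀ := by
    have h1 : (M.U x).toReal ≤ m := by
      have := hm x hx
      rw [← EReal.coe_toReal (M.U_ne_top x (nonneg_of_mem_box hx)) hUx] at this
      exact_mod_cast this
    have := mul_le_mul_of_nonneg_left h1 M.V_pos.le
    linarith
  -- `10 b + 4 c₀` is the coefficient of `S` in the integrated bound; the extra `1` pays for the
  -- term `-S` in the conclusion.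
  set c := 10 * b + 4 * c₀ + 1 with hc
  have hcpos : 0 < c := by positivity
  refine ⟨2 * b₂ + c * (c / (4 * δ)) ^ 2, by positivity, fun q hq => ?_⟩
  set S := ∑ k, q k ^ 2 with hS
  have hS0 : 0 ≤ S := Finset.sum_nonneg fun k _ => sq_nonneg _
  set T := ∑ k, q k with hT
  have hT0 : 0 ≤ T := Finset.sum_nonneg fun k _ => hq k
  have hST : S ≤ T ^ 2 := Finset.sum_sq_le_sq_sum_of_nonneg fun k _ => hq k
  set η := ∑ k, M.arrival q k * q k - ∑ k, q k * M.meanRate q k with hη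
  -- Arrivals are compared with `x` and mean rates with `z`; the gap `δ` between the two gives the
  -- negative drift.
  have hη_le : η ≤ c₀ - δ * T := by
    obtain ⟨h1, h2⟩ := M.util_spec hq hx hUx
    have h3 : M.util q ≤ m := by
      have := hm _ (M.arrival_mem q)
      rw [← h1] at this
      exact_mod_cast this
    have h4 := M.max_weight q hq z hz
    have h5 : ∑ k, x k * q k + δ * T ≤ ∑ k, q k * z k := by
      rw [hT, Finset.mul_sum, ← Finset.sum_add_distrib]
      refine Finset.sum_le_sum fun k _ => ?_
      have := mul_le_mul_of_nonneg_left (hxz k) (hq k)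
      linarith
    have h6 := mul_le_mul_of_nonneg_left h3 M.V_pos.le
    simp only [hη, meanRate]
    linarith
  have hpt : ∀ w, (∑ k, M.step q w k ^ 2) ^ 2 ≤
      (S ^ 2 + 4 * S * η) + (10 * S) * M.incr w + (4 * S) * M.noise q w + 2 * M.incr w ^ 2 := by
    intro w
    set ζ := ∑ k, q k * (M.arrival q k - M.rate q w k) with hζ
    have h1 := M.sum_sq_step_le hq w
    have h2 : ζ = η + M.noise q w := by
      simp only [hζ, hη, noise, mul_sub, Finset.sum_sub_distrib, mul_comm (M.arrival q _)]
      ring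
    -- Cauchy–Schwarz. With it, `8 ζ²` adds `8 S incr` to the `2 S incr` of the cross term, whence
    -- the factor `10`.
    have h3 : ζ ^ 2 ≤ S * M.incr w := by
      refine (Finset.sum_mul_sq_le_sq_mul_sq _ _ _).trans (mul_le_mul_of_nonneg_left ?_ hS0)
      have : M.incr w = ∑ k, (M.A ^ 2 + M.bnd w k ^ 2) := by
        simp only [incr, Finset.sum_add_distrib, Finset.sum_const, Finset.card_univ,
          Fintype.card_fin, nsmul_eq_mul]
      rw [this]
      refine Finset.sum_le_sum fun k _ => ?_
      obtain ⟨h4, h5⟩ := M.arrival_mem q k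
      have h6 := pow_le_pow_left₀ h4 h5 2
      have h7 := pow_le_pow_left₀ (M.rate_nonneg q w k) (M.rate_le q w k) 2
      nlinarith [mul_nonneg h4 (M.rate_nonneg q w k)]
    have h4 : ∑ k, M.step q w k ^ 2 ≤ S + (M.incr w + 2 * ζ) := by
      have : ζ = ∑ k, M.arrival q k * q k - ∑ k, q k * M.rate q w k := by
        simp only [hζ, mul_sub, Finset.sum_sub_distrib, mul_comm (M.arrival q _)]
      linarith
    have h5 := pow_le_pow_left₀ (Finset.sum_nonneg fun k _ => sq_nonneg (M.step q w k)) h4 2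
    have h6 : (M.incr w + 2 * ζ) ^ 2 ≤ 2 * M.incr w ^ 2 + 8 * ζ ^ 2 := by
      nlinarith [sq_nonneg (M.incr w - 2 * ζ)]
    calc (∑ k, M.step q w k ^ 2) ^ 2 ≤ (S + (M.incr w + 2 * ζ)) ^ 2 := h5
      _ = S ^ 2 + 2 * S * (M.incr w + 2 * ζ) + (M.incr w + 2 * ζ) ^ 2 := by ring
      _ ≤ S ^ 2 + 2 * S * (M.incr w + 2 * ζ) + (2 * M.incr w ^ 2 + 8 * (S * M.incr w)) := by
          linarith
      _ = _ := by rw [h2]; ring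
  have i1 : Integrable (fun _ : E => S ^ 2 + 4 * S * η) M.law := integrable_const _
  have i2 := M.integrable_incr.const_mul (10 * S)
  have i3 := (M.integrable_noise q).const_mul (4 * S)
  have i4 := M.memLp_incr.integrable_sq.const_mul 2
  have hmain : ∫ w, (∑ k, M.step q w k ^ 2) ^ 2 ∂M.law ≤
      (S ^ 2 + 4 * S * η) + 10 * S * b + 2 * b₂ := by
    calc ∫ w, (∑ k, M.step q w k ^ 2) ^ 2 ∂M.law ≤ ∫ w, ((S ^ 2 + 4 * S * η) +
          (10 * S) * M.incr w + (4 * S) * M.noise q w + 2 * M.incr w ^ 2) ∂M.law :=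
          integral_mono_of_nonneg (ae_of_all _ fun w => sq_nonneg _)
            (((i1.add i2).add i3).add i4) (ae_of_all _ hpt)
      _ = _ := by
          have i12 : Integrable (fun w => (S ^ 2 + 4 * S * η) + (10 * S) * M.incr w) M.law :=
            i1.add i2
          have i123 : Integrable (fun w => (S ^ 2 + 4 * S * η) + (10 * S) * M.incr w +
            (4 * S) * M.noise q w) M.law := i12.add i3
          rw [integral_add i123 i4, integral_add i12 i3, integral_add i1 i2, integral_const_mul, integral_const_mul, integral_const_mul,
            M.integral_noise]
          simp [hb, hb₂]
  have h1 : 4 * S * η ≤ 4 * S * (c₀ - δ * T) := mul_le_mul_of_nonneg_left hη_le (by positivity)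
  -- For `T ≥ c / (4 δ)` the negative drift outweighs `S c`; for smaller `T` the bound `S ≤ T²`
  -- makes `S c` at most a constant.
  have h2 : S * c - 4 * δ * (S * T) ≤ c * (c / (4 * δ)) ^ 2 := by
    rcases le_total (c / (4 * δ)) T with h | h
    · have : c ≤ 4 * δ * T := by
        rw [div_le_iff₀ (by positivity)] at h; linarith
      have h3 := mul_le_mul_of_nonneg_left this hS0
      have h4 : 0 ≤ c * (c / (4 * δ)) ^ 2 := by positivity
      linarith
    · have h3 : S ≤ (c / (4 * δ)) ^ 2 := hST.trans (pow_le_pow_left₀ hT0 h 2)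
      have h4 := mul_le_mul_of_nonneg_right h3 hcpos.le
      have h5 : 0 ≤ 4 * δ * (S * T) := by positivity
      linarith
  have h3 : S * c = 10 * S * b + 4 * S * c₀ + S := by rw [hc]; ring
  nlinarith

/-! ### Random trajectories: queue moments, rate stability, averaged noise. -/

section Trajectories

variable {Ω : Type*} {m0 : MeasurableSpace Ω} {μ : Measure Ω}
  {W : ℕ → Ω → E} {q₀ : Fin K → ℝ}

theorem measurable_queue_past (hW : ∀ t, Measurable (W t)) (t : ℕ) :
    Measurable[past W hW t] fun ω => M.queue q₀ (fun s => W s ω) t := by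
  induction t with
  | zero => exact measurable_const
  | succ t ih =>
    have h1 : Measurable[past W hW (t + 1)] fun ω => M.queue q₀ (fun s => W s ω) t :=
      ih.mono ((past W hW).mono (Nat.le_succ t)) le_rfl
    exact M.measurable_step.comp (h1.prodMk (measurable_past_succ hW t))

theorem measurable_queue (hW : ∀ t, Measurable (W t)) (t : ℕ) :
    Measurable fun ω => M.queue q₀ (fun s => W s ω) t :=
  (M.measurable_queue_past hW t).mono ((past W hW).le t) le_rfl

/-- At a fixed time the queues lie in a deterministic compact box, since a slot adds at most `A`.
This settles integrability of every continuous function of them. -/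
theorem exists_bound_continuous_queue (hq₀ : 0 ≤ q₀) {f : (Fin K → ℝ) → ℝ} (hf : Continuous f)
    (t : ℕ) : ∃ c, ∀ w : ℕ → E, |f (M.queue q₀ w t)| ≤ c := by
  obtain ⟨c, hc⟩ := (isCompact_Icc (a := (0 : Fin K → ℝ))
        (b := fun k => q₀ k + t * M.A)).exists_bound_of_continuousOn
    hf.continuousOn
  exact ⟨c, fun w => hc _ ⟨M.queue_nonneg hq₀ w t, fun k => M.queue_le hq₀ w t k⟩⟩

theorem integrable_continuous_queue [IsProbabilityMeasure μ] (hW : ∀ t, Measurable (W t))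
    (hq₀ : 0 ≤ q₀) {f : (Fin K → ℝ) → ℝ} (hf : Continuous f) (t : ℕ) :
    Integrable (fun ω => f (M.queue q₀ (fun s => W s ω) t)) μ := by
  obtain ⟨c, hc⟩ := M.exists_bound_continuous_queue hq₀ hf t
  exact Integrable.of_bound ((hf.measurable.comp (M.measurable_queue hW t)).aestronglyMeasurable) c
    (ae_of_all _ fun ω => hc _)

theorem integrable_comp_slot (hW : ∀ t, Measurable (W t)) (hlaw : ∀ t, μ.map (W t) = M.law)
    {f : E → ℝ} (hf : Integrable f M.law) (t : ℕ) : Integrable (fun ω => f (W t ω)) μ := by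
  rw [← hlaw t] at hf
  exact hf.comp_measurable (hW t)

theorem integral_comp_slot (hW : ∀ t, Measurable (W t)) (hlaw : ∀ t, μ.map (W t) = M.law)
    {f : E → ℝ} (hf : Measurable f) (t : ℕ) : ∫ ω, f (W t ω) ∂μ = ∫ w, f w ∂M.law := by
  rw [← hlaw t, integral_map (hW t).aemeasurable hf.aestronglyMeasurable]

theorem ae_tendsto_average_slot (hW : ∀ t, Measurable (W t))
    (hlaw : ∀ t, μ.map (W t) = M.law) (hind : iIndepFun W μ) {f : E → ℝ} (hf : Measurable f)
    (hint : Integrable f M.law) :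
    ∀ᵐ ω ∂μ, Tendsto (fun n : ℕ => (n : ℝ)⁻¹ * ∑ t ∈ Finset.range n, f (W t ω)) atTop
      (𝓝 (∫ w, f w ∂M.law)) := by
  have h := strong_law_ae_real (μ := μ) (fun t ω => f (W t ω))
    (M.integrable_comp_slot hW hlaw hint 0)
    (fun s t hst => (hind.indepFun hst).comp hf hf)
    (fun t => by
      refine IdentDistrib.comp (u := f) ⟨(hW t).aemeasurable, (hW 0).aemeasurable, ?_⟩ hf
      rw [hlaw, hlaw])
  rw [M.integral_comp_slot hW hlaw hf 0] at h
  filter_upwards [h] with ω hω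
  simpa only [div_eq_inv_mul] using hω

theorem integrable_rate_queue (hW : ∀ t, Measurable (W t)) (hlaw : ∀ t, μ.map (W t) = M.law)
    (t : ℕ) (k : Fin K) :
    Integrable (fun ω => M.rate (M.queue q₀ (fun s => W s ω) t) (W t ω) k) μ := by
  refine (M.integrable_comp_slot hW hlaw (M.integrable_bnd k) t).mono'
    ((M.measurable_rate_apply k).comp
      ((M.measurable_queue hW t).prodMk (hW t))).aestronglyMeasurable (ae_of_all _ fun ω => ?_)
  rw [Real.norm_of_nonneg (M.rate_nonneg _ _ k)]
  exact M.rate_le _ _ k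

variable [IsProbabilityMeasure μ]

theorem quartic_drift_queue (hW : ∀ t, Measurable (W t)) (hlaw : ∀ t, μ.map (W t) = M.law)
    (hind : iIndepFun W μ) (hq₀ : 0 ≤ q₀) {C : ℝ}
    (hC : ∀ q, 0 ≤ q →
      ∫ w, (∑ k, M.step q w k ^ 2) ^ 2 ∂M.law ≤ (∑ k, q k ^ 2) ^ 2 + C - ∑ k, q k ^ 2) (t : ℕ) :
    ∫ ω, ∑ k, M.queue q₀ (fun s => W s ω) t k ^ 2 ∂μ ≤
      ∫ ω, (∑ k, M.queue q₀ (fun s => W s ω) t k ^ 2) ^ 2 ∂μ -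
      ∫ ω, (∑ k, M.queue q₀ (fun s => W s ω) (t + 1) k ^ 2) ^ 2 ∂μ + C := by
  have hc1 : Continuous fun q : Fin K → ℝ => ∑ k, q k ^ 2 := by fun_prop
  have hc2 : Continuous fun q : Fin K → ℝ => (∑ k, q k ^ 2) ^ 2 := by fun_prop
  have i1 := M.integrable_continuous_queue (μ := μ) hW hq₀ hc1 t
  have i2 := M.integrable_continuous_queue (μ := μ) hW hq₀ hc2 t
  have i3 := M.integrable_continuous_queue (μ := μ) hW hq₀ hc2 (t + 1)
  obtain ⟨h1, h2⟩ := integral_past hW hlaw hind (M.measurable_queue_past (q₀ := q₀) hW t)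
    (hc2.measurable.comp M.measurable_step) i3
  have i4 : Integrable
      (fun ω => (∑ k, M.queue q₀ (fun s => W s ω) t k ^ 2) ^ 2 + C) μ :=
    i2.add (integrable_const C)
  have h3 : ∫ ω, (∑ k, M.queue q₀ (fun s => W s ω) (t + 1) k ^ 2) ^ 2 ∂μ ≤
      ∫ ω, ((∑ k, M.queue q₀ (fun s => W s ω) t k ^ 2) ^ 2 + C -
        ∑ k, M.queue q₀ (fun s => W s ω) t k ^ 2) ∂μ :=
    h2.trans_le (integral_mono h1 (i4.sub i1) fun ω =>
      hC _ (M.queue_nonneg hq₀ _ t))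
  rw [integral_sub i4 i1, integral_add i2 (integrable_const _)] at h3
  simp only [integral_const, probReal_univ, one_smul] at h3
  linarith

/-- The drift of the squared Lyapunov function, summed against `1/(t+1)²`: the weights required both
for rate stability and for the strong law of the noise. -/
theorem summable_mean_sq (hW : ∀ t, Measurable (W t)) (hlaw : ∀ t, μ.map (W t) = M.law)
    (hind : iIndepFun W μ) (hq₀ : 0 ≤ q₀) {C : ℝ} (hC0 : 0 ≤ C)
    (hC : ∀ q, 0 ≤ q →
      ∫ w, (∑ k, M.step q w k ^ 2) ^ 2 ∂M.law ≤ (∑ k, q k ^ 2) ^ 2 + C - ∑ k, q k ^ 2) :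
    Summable fun t : ℕ => (∫ ω, ∑ k, M.queue q₀ (fun s => W s ω) t k ^ 2 ∂μ) *
      (((t : ℝ) + 1) ^ 2)⁻¹ :=
  summable_weighted_of_drift
    (fun _ => integral_nonneg fun _ => Finset.sum_nonneg fun _ _ => sq_nonneg _)
    (fun t => integral_nonneg fun _ => sq_nonneg _) (fun t => by positivity)
    antitone_inv_succ_sq summable_inv_succ_sq hC0
    (M.quartic_drift_queue hW hlaw hind hq₀ hC)

theorem sum_mean_sq_le (hW : ∀ t, Measurable (W t)) (hlaw : ∀ t, μ.map (W t) = M.law)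
    (hind : iIndepFun W μ) (hq₀ : 0 ≤ q₀) {C : ℝ}
    (hC : ∀ q, 0 ≤ q →
      ∫ w, (∑ k, M.step q w k ^ 2) ^ 2 ∂M.law ≤ (∑ k, q k ^ 2) ^ 2 + C - ∑ k, q k ^ 2) (n : ℕ) :
    ∑ t ∈ Finset.range n, ∫ ω, ∑ k, M.queue q₀ (fun s => W s ω) t k ^ 2 ∂μ ≤
      (∑ k, q₀ k ^ 2) ^ 2 + C * n := by
  have h : ∀ n, ∑ t ∈ Finset.range n, ∫ ω, ∑ k, M.queue q₀ (fun s => W s ω) t k ^ 2 ∂μ ≤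
      (∑ k, q₀ k ^ 2) ^ 2 - ∫ ω, (∑ k, M.queue q₀ (fun s => W s ω) n k ^ 2) ^ 2 ∂μ + C * n := by
    intro n
    induction n with
    | zero => simp [queue]
    | succ n ih =>
      rw [Finset.sum_range_succ]
      have := M.quartic_drift_queue hW hlaw hind hq₀ hC n
      push_cast
      linarith
  have h1 : 0 ≤ ∫ ω, (∑ k, M.queue q₀ (fun s => W s ω) n k ^ 2) ^ 2 ∂μ :=
    integral_nonneg fun _ => sq_nonneg _
  linarith [h n]

/-- The queues are almost surely rate stable. -/
theorem ae_tendsto_queue_div (hW : ∀ t, Measurable (W t)) (hq₀ : 0 ≤ q₀)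
    (hs : Summable fun t : ℕ => (∫ ω, ∑ k, M.queue q₀ (fun s => W s ω) t k ^ 2 ∂μ) *
      (((t : ℝ) + 1) ^ 2)⁻¹) :
    ∀ᵐ ω ∂μ, ∀ k, Tendsto (fun n : ℕ => M.queue q₀ (fun s => W s ω) n k / ((n : ℝ) + 1)) atTop
      (𝓝 0) := by
  have hc1 : Continuous fun q : Fin K → ℝ => ∑ k, q k ^ 2 := by fun_prop
  have h1 := ae_summable_of_summable_integral (μ := μ)
    (f := fun t ω => (∑ k, M.queue q₀ (fun s => W s ω) t k ^ 2) * (((t : ℝ) + 1) ^ 2)⁻¹)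
    (fun t ω => mul_nonneg (Finset.sum_nonneg fun _ _ => sq_nonneg _) (by positivity))
    (fun t => (M.integrable_continuous_queue hW hq₀ hc1 t).mul_const _)
    (by simpa only [integral_mul_const] using hs)
  filter_upwards [h1] with ω hω k
  have h2 : Tendsto (fun t : ℕ => (M.queue q₀ (fun s => W s ω) t k / ((t : ℝ) + 1)) ^ 2) atTop
      (𝓝 0) := by
    refine squeeze_zero (fun t => sq_nonneg _) (fun t => ?_) hω.tendsto_atTop_zero
    rw [div_pow, div_eq_mul_inv]
    refine mul_le_mul_of_nonneg_right ?_ (by positivity)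
    exact Finset.single_le_sum (f := fun k => M.queue q₀ (fun s => W s ω) t k ^ 2)
      (fun _ _ => sq_nonneg _) (Finset.mem_univ k)
  have h3 := h2.sqrt
  rw [Real.sqrt_zero] at h3
  refine h3.congr fun t => Real.sqrt_sq (div_nonneg (M.queue_nonneg hq₀ _ t k) (by positivity))

theorem memLp_noise_queue (hW : ∀ t, Measurable (W t)) (hlaw : ∀ t, μ.map (W t) = M.law)
    (hind : iIndepFun W μ) (hq₀ : 0 ≤ q₀) (t : ℕ) :
    MemLp (fun ω => M.noise (M.queue q₀ (fun s => W s ω) t) (W t ω)) 2 μ ∧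
    ∫ ω, M.noise (M.queue q₀ (fun s => W s ω) t) (W t ω) ^ 2 ∂μ ≤
      (∫ ω, ∑ k, M.queue q₀ (fun s => W s ω) t k ^ 2 ∂μ) *
        ∫ w, ∑ k, ((∫ w, M.bnd w k ∂M.law) ^ 2 + M.bnd w k ^ 2) ∂M.law := by
  have hc1 : Continuous fun q : Fin K → ℝ => ∑ k, q k ^ 2 := by fun_prop
  set c : E → ℝ := fun w => ∑ k, ((∫ w, M.bnd w k ∂M.law) ^ 2 + M.bnd w k ^ 2) with hc
  have hcm : Measurable c := by
    have := M.measurable_bnd_apply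
    fun_prop
  have hci : Integrable c M.law := integrable_finsetSum _ fun k _ =>
    (integrable_const _).add ((M.memLp_bnd_sq k).integrable (by norm_num))
  have hm : Measurable fun ω => M.noise (M.queue q₀ (fun s => W s ω) t) (W t ω) :=
    M.measurable_noise.comp ((M.measurable_queue hW t).prodMk (hW t))
  have hprod : Integrable
      (fun ω => (∑ k, M.queue q₀ (fun s => W s ω) t k ^ 2) * c (W t ω)) μ := by
    obtain ⟨b, hb⟩ := M.exists_bound_continuous_queue (q₀ := q₀) hq₀ hc1 t
    exact (M.integrable_comp_slot hW hlaw hci t).bdd_mul (c := b)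
      (hc1.measurable.comp (M.measurable_queue hW t)).aestronglyMeasurable
      (ae_of_all _ fun ω => hb _)
  have hsq : Integrable
      (fun ω => M.noise (M.queue q₀ (fun s => W s ω) t) (W t ω) ^ 2) μ :=
    hprod.mono' (hm.pow_const 2).aestronglyMeasurable (ae_of_all _ fun ω => by
      rw [Real.norm_of_nonneg (sq_nonneg _)]; exact M.noise_sq_le _ _)
  refine ⟨(memLp_two_iff_integrable_sq hm.aestronglyMeasurable).2 hsq, ?_⟩
  refine (integral_mono hsq hprod fun ω => M.noise_sq_le _ _).trans (le_of_eq ?_)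
  have hG : Measurable fun p : (Fin K → ℝ) × E => (∑ k, p.1 k ^ 2) * c p.2 := by fun_prop
  have h := (integral_past hW hlaw hind (M.measurable_queue_past (q₀ := q₀) hW t) hG hprod).2
  simp only [integral_const_mul] at h
  rw [h, integral_mul_const]

theorem integral_noise_queue (hW : ∀ t, Measurable (W t)) (hlaw : ∀ t, μ.map (W t) = M.law)
    (hind : iIndepFun W μ) (hq₀ : 0 ≤ q₀) (t : ℕ) :
    ∫ ω, M.noise (M.queue q₀ (fun s => W s ω) t) (W t ω) ∂μ = 0 := by
  have h := (integral_past hW hlaw hind (M.measurable_queue_past (q₀ := q₀) hW t)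
    M.measurable_noise ((M.memLp_noise_queue hW hlaw hind hq₀ t).1.integrable (by norm_num))).2
  simpa only [integral_noise, integral_zero] using h

theorem ae_tendsto_average_noise (hW : ∀ t, Measurable (W t))
    (hlaw : ∀ t, μ.map (W t) = M.law) (hind : iIndepFun W μ) (hq₀ : 0 ≤ q₀)
    (hs : Summable fun t : ℕ => (∫ ω, ∑ k, M.queue q₀ (fun s => W s ω) t k ^ 2 ∂μ) *
      (((t : ℝ) + 1) ^ 2)⁻¹) :
    ∀ᵐ ω ∂μ, Tendsto (fun n : ℕ => (n : ℝ)⁻¹ * ∑ t ∈ Finset.range n,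
      M.noise (M.queue q₀ (fun s => W s ω) t) (W t ω)) atTop (𝓝 0) := by
  refine ae_tendsto_average_of_condExp_eq_zero (ℱ := past W hW)
    (d := fun t ω => M.noise (M.queue q₀ (fun s => W s ω) t) (W t ω)) (fun t => ?_)
    (fun t => (M.memLp_noise_queue hW hlaw hind hq₀ t).1) (fun t => ?_) ?_
  · have h1 : Measurable[past W hW (t + 1)] fun ω => M.queue q₀ (fun s => W s ω) t :=
      (M.measurable_queue_past hW t).mono ((past W hW).mono (Nat.le_succ t)) le_rfl
    exact (M.measurable_noise.comp (h1.prodMk (measurable_past_succ hW t))).stronglyMeasurable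
  · exact condExp_past_eq_zero hW hlaw hind (M.measurable_queue_past (q₀ := q₀) hW t)
      M.measurable_noise ((M.memLp_noise_queue hW hlaw hind hq₀ t).1.integrable (by norm_num))
      fun ω => M.integral_noise _
  · refine Summable.of_nonneg_of_le
      (fun t => mul_nonneg (integral_nonneg fun _ => sq_nonneg _) (by positivity))
      (fun t => mul_le_mul_of_nonneg_right (M.memLp_noise_queue hW hlaw hind hq₀ t).2
        (by positivity)) ?_
    refine (hs.mul_right (∫ w, ∑ k, ((∫ w, M.bnd w k ∂M.law) ^ 2 + M.bnd w k ^ 2) ∂M.law)).congr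
      fun t => ?_
    ring

end Trajectories

theorem average_mem {F : Type*} [AddCommGroup F] [Module ℝ F] {s : Set F} (hs : Convex ℝ s)
    {f : ℕ → F} (hf : ∀ t, f t ∈ s) {n : ℕ} (hn : 0 < n) :
    (1 / (n : ℝ)) • ∑ τ ∈ Finset.Icc 1 n, f τ ∈ s := by
  rw [Finset.smul_sum]
  refine hs.sum_mem (fun _ _ => by positivity) ?_ fun t _ => hf t
  simp [hn.ne']

theorem hypograph_util_mem {q x : Fin K → ℝ} (hq : 0 ≤ q) (hx : x ∈ box K M.A)
    (hUx : M.U x ≠ ⊥) : (M.arrival q, M.util q) ∈ hypograph M.U :=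
  ⟨nonneg_of_mem_box (M.arrival_mem q), (M.util_spec hq hx hUx).1.le⟩

/-- The telescoped drift with competitor `Rs`: since `Rs` is achievable, max-weight cancels the
terms linear in the queues. The bound holds on every path, as (a) requires. -/
theorem sum_sq_queue_le {q₀ : Fin K → ℝ} (hq₀ : 0 ≤ q₀) {Rs : Fin K → ℝ}
    (hRs : Rs ∈ M.region ∩ box K M.A) (hURs : M.U Rs ≠ ⊥) (w : ℕ → E) (n : ℕ) :
    ∑ k, M.queue q₀ w (n + 1) k ^ 2 ≤ ∑ k, M.queue q₀ w 1 k ^ 2 +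
      ∑ τ ∈ Finset.Icc 1 n, M.incr (w τ) +
      2 * (M.V * ∑ τ ∈ Finset.Icc 1 n, M.util (M.queue q₀ w τ) - n * (M.V * (M.U Rs).toReal) +
        ∑ τ ∈ Finset.Icc 1 n, M.noise (M.queue q₀ w τ) (w τ)) := by
  induction n with
  | zero => simp
  | succ n ih =>
    have hq := M.queue_nonneg hq₀ w (n + 1)
    have h1 := M.drift_le hq hRs.2 hURs (w (n + 1))
    have h2 := M.max_weight _ hq Rs hRs.1
    have h3 : ∑ k, Rs k * M.queue q₀ w (n + 1) k ≤
        ∑ k, M.queue q₀ w (n + 1) k * M.meanRate (M.queue q₀ w (n + 1)) k := by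
      simpa only [meanRate, mul_comm (Rs _)] using h2
    rw [Finset.sum_Icc_succ_top (by lia), Finset.sum_Icc_succ_top (by lia),
      Finset.sum_Icc_succ_top (by lia)]
    change ∑ k, M.step (M.queue q₀ w (n + 1)) (w (n + 1)) k ^ 2 ≤ _
    push_cast
    linarith

/-- As `max 0 (Q - R) ≥ Q - R`, whatever arrived and was not served is still queued. The content of
the queue at time `1` is dropped. -/
theorem sum_arrival_le (q₀ : Fin K → ℝ) (hq₀ : 0 ≤ q₀) (w : ℕ → E) (k : Fin K) (n : ℕ) :
    ∑ τ ∈ Finset.Icc 1 n, M.arrival (M.queue q₀ w τ) k ≤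
      ∑ τ ∈ Finset.Icc 1 n, M.rate (M.queue q₀ w τ) (w τ) k + M.queue q₀ w (n + 1) k := by
  induction n with
  | zero => simpa using M.queue_nonneg hq₀ w 1 k
  | succ n ih =>
    rw [Finset.sum_Icc_succ_top (by lia), Finset.sum_Icc_succ_top (by lia)]
    have h : M.queue q₀ w (n + 1 + 1) k = max 0 (M.queue q₀ w (n + 1) k -
      M.rate (M.queue q₀ w (n + 1)) (w (n + 1)) k) + M.arrival (M.queue q₀ w (n + 1)) k := rfl
    have h2 := le_max_right 0 (M.queue q₀ w (n + 1) k -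
      M.rate (M.queue q₀ w (n + 1)) (w (n + 1)) k)
    linarith

theorem exists_stable_constant {r Rs : Fin K → ℝ} (hr : r ∈ M.region) (hr0 : ∀ k, 0 < r k)
    (hRs : Rs ∈ M.region ∩ box K M.A) (hURs : M.U Rs ≠ ⊥) :
    ∃ C : ℝ, 0 ≤ C ∧ ∀ q, 0 ≤ q →
      ∫ w, (∑ k, M.step q w k ^ 2) ^ 2 ∂M.law ≤ (∑ k, q k ^ 2) ^ 2 + C - ∑ k, q k ^ 2 := by
  obtain ⟨x, hx, hUx, δ, hδ, z, hz, hxz⟩ :=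
    exists_slack M.U_cont M.A_pos M.region_convex hr hr0 hRs hURs
  exact M.exists_quartic_drift hx hUx hδ hz hxz

theorem tendsto_succ_div {f : ℕ → ℝ} (h : Tendsto (fun n : ℕ => f n / ((n : ℝ) + 1)) atTop (𝓝 0)) :
    Tendsto (fun n : ℕ => f (n + 1) / (n : ℝ)) atTop (𝓝 0) := by
  have h1 := (tendsto_natCast_div_add_atTop (2 : ℝ)).inv₀ one_ne_zero
  have h2 := ((tendsto_add_atTop_iff_nat 1).2 h).mul h1
  rw [zero_mul] at h2
  refine h2.congr' ?_
  filter_upwards [eventually_gt_atTop 0] with n hn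
  have hn' : (n : ℝ) ≠ 0 := by positivity
  have hn'' : (n : ℝ) + 1 + 1 ≠ 0 := by positivity
  have hn''' : (n : ℝ) + 2 ≠ 0 := by positivity
  push_cast
  field_simp
  ring

/-! ### Asymptotic utility and queue bounds. -/

section Trajectories

variable {Ω : Type*} {m0 : MeasurableSpace Ω} {μ : Measure Ω} [IsProbabilityMeasure μ]
  {W : ℕ → Ω → E} {q₀ : Fin K → ℝ}

/-- Almost sure near-optimality of the utility of the average service rates. -/
theorem ae_le_liminf_utility (hW : ∀ t, Measurable (W t)) (hlaw : ∀ t, μ.map (W t) = M.law)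
    (hind : iIndepFun W μ) (hq₀ : 0 ≤ q₀) {r Rs : Fin K → ℝ} (hr : r ∈ M.region)
    (hr0 : ∀ k, 0 < r k) (hRs : Rs ∈ M.region ∩ box K M.A) (hURs : M.U Rs ≠ ⊥) :
    ∀ᵐ ω ∂μ, M.U Rs - (((1 / 2 * ∫ w, M.incr w ∂M.law) / M.V : ℝ) : EReal) ≤
      liminf (fun n : ℕ => M.U ((1 / (n : ℝ)) • ∑ τ ∈ Finset.Icc 1 n,
        M.rate (M.queue q₀ (fun s => W s ω) τ) (W τ ω))) atTop := by
  obtain ⟨C, hC0, hC⟩ := M.exists_stable_constant hr hr0 hRs hURs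
  have hs := M.summable_mean_sq hW hlaw hind hq₀ hC0 hC
  have hbnd : ∀ᵐ ω ∂μ, ∀ k, Tendsto (fun n : ℕ => (n : ℝ)⁻¹ * ∑ t ∈ Finset.range n,
      M.bnd (W t ω) k) atTop (𝓝 (∫ w, M.bnd w k ∂M.law)) :=
    ae_all_iff.2 fun k => M.ae_tendsto_average_slot hW hlaw hind (M.measurable_bnd_apply k)
      (M.integrable_bnd k)
  filter_upwards [M.ae_tendsto_queue_div hW hq₀ hs, M.ae_tendsto_average_noise hW hlaw hind hq₀ hs,
    M.ae_tendsto_average_slot hW hlaw hind M.measurable_incr M.integrable_incr, hbnd]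
    with ω hQ hN hI hB
  replace hN := tendsto_average_Icc hN
  replace hI := tendsto_average_Icc hI
  set w : ℕ → E := fun s => W s ω with hw
  set u := (M.U Rs).toReal with hu
  have hRs0 := nonneg_of_mem_box hRs.2
  have hUu : M.U Rs = (u : EReal) := (EReal.coe_toReal (M.U_ne_top Rs hRs0) hURs).symm
  set κ := 1 / 2 * ∫ w, M.incr w ∂M.law with hκ
  rw [le_liminf_iff]
  intro y hy
  -- The lower bound on the average utility of the arrivals obtained from the telescoped drift after
  -- division by `2 n V`. Its last correction is the initial Lyapunov value.
  set v : ℕ → ℝ := fun n => u - (1 / 2 * ((1 / (n : ℝ)) * ∑ τ ∈ Finset.Icc 1 n, M.incr (w τ)) +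
    (1 / (n : ℝ)) * ∑ τ ∈ Finset.Icc 1 n, M.noise (M.queue q₀ w τ) (w τ) +
    1 / (n : ℝ) * (1 / 2 * ∑ k, M.queue q₀ w 1 k ^ 2)) / M.V with hv
  have hvl : Tendsto v atTop (𝓝 (u - κ / M.V)) := by
    have h1 : Tendsto (fun n : ℕ => 1 / (n : ℝ) * (1 / 2 * ∑ k, M.queue q₀ w 1 k ^ 2)) atTop
        (𝓝 0) := by
      simpa using (tendsto_one_div_atTop_nhds_zero_nat (𝕜 := ℝ)).mul_const
        (1 / 2 * ∑ k, M.queue q₀ w 1 k ^ 2)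
    have h2 := ((((hI.const_mul (1 / 2)).add hN).add h1).div_const M.V).const_sub u
    simpa only [add_zero] using h2
  refine eventually_lt_utility M.U_cont M.U_mono (v := fun n => (v n : EReal))
    (z := fun n => (1 / (n : ℝ)) • ∑ τ ∈ Finset.Icc 1 n, M.arrival (M.queue q₀ w τ))
    (ε := fun n k => M.queue q₀ w (n + 1) k / (n : ℝ)) (fun n => ?_) (fun n => ?_) (fun n k => ?_)
    ?_ ?_ ?_ ?_ ((continuous_coe_real_ereal.tendsto _).comp hvl) (by
      rw [EReal.coe_sub, ← hUu]; exact hy)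
  · exact smul_nonneg (by positivity) (Finset.sum_nonneg fun τ _ k => M.rate_nonneg _ _ k)
  · exact smul_nonneg (by positivity) (Finset.sum_nonneg fun τ _ =>
      nonneg_of_mem_box (M.arrival_mem _))
  · exact div_nonneg (M.queue_nonneg hq₀ w _ k) (by positivity)
  · have h1 : ∀ k, ∃ c, ∀ n : ℕ, (1 / (n : ℝ)) * ∑ τ ∈ Finset.Icc 1 n, M.bnd (w τ) k ≤ c := by
      intro k
      obtain ⟨c, hc⟩ := (tendsto_average_Icc (hB k)).bddAbove_range
      exact ⟨c, fun n => hc ⟨n, rfl⟩⟩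
    choose c hc using h1
    refine (Metric.isBounded_Icc (0 : Fin K → ℝ) c).subset ?_
    rintro _ ⟨n, rfl⟩
    refine ⟨smul_nonneg (by positivity) (Finset.sum_nonneg fun τ _ k => M.rate_nonneg _ _ k),
      fun k => le_trans ?_ (hc k n)⟩
    simp only [Pi.smul_apply, Finset.sum_apply, smul_eq_mul]
    gcongr with τ _
    exact M.rate_le _ _ k
  · exact tendsto_pi_nhds.2 fun k => tendsto_succ_div (hQ k)
  · refine Eventually.of_forall fun n k => ?_
    have h1 := M.sum_arrival_le q₀ hq₀ w k n
    simp only [Pi.smul_apply, Pi.add_apply, Finset.sum_apply, smul_eq_mul]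
    calc _ ≤ (1 / (n : ℝ)) * (∑ τ ∈ Finset.Icc 1 n, M.rate (M.queue q₀ w τ) (w τ) k +
          M.queue q₀ w (n + 1) k) := by gcongr
      _ = _ := by ring
  · filter_upwards [eventually_gt_atTop 0] with n hn
    have h1 := average_mem (convex_hypograph M.U_conc) (fun τ =>
      M.hypograph_util_mem (M.queue_nonneg hq₀ w τ) hRs.2 hURs) hn
    have h2 := h1.2
    simp only [Prod.smul_fst, Prod.smul_snd, Prod.fst_sum, Prod.snd_sum, smul_eq_mul] at h2
    refine le_trans ?_ h2
    rw [EReal.coe_le_coe_iff]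
    have h3 := M.sum_sq_queue_le hq₀ hRs hURs w n
    have h4 : 0 ≤ ∑ k, M.queue q₀ w (n + 1) k ^ 2 := Finset.sum_nonneg fun _ _ => sq_nonneg _
    have hn' : (0 : ℝ) < n := by exact_mod_cast hn
    simp only [hv]
    have hV := M.V_pos
    rw [sub_le_iff_le_add, ← sub_le_iff_le_add', le_div_iff₀ hV]
    refine le_of_mul_le_mul_left ?_ hn'
    field_simp
    rw [← hu] at h3
    linarith

/-- The utility of the arrivals is bounded above on the box. From below, comparison with `x` costs
at most `(∑ x_k q_k) / V`, which is bounded at a fixed time. -/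
theorem integrable_util_queue (hW : ∀ t, Measurable (W t)) (hq₀ : 0 ≤ q₀) {x : Fin K → ℝ}
    (hx : x ∈ box K M.A) (hUx : M.U x ≠ ⊥) (t : ℕ) :
    Integrable (fun ω => M.util (M.queue q₀ (fun s => W s ω) t)) μ := by
  obtain ⟨m, hm⟩ := exists_bound_on_box M.U_cont M.U_ne_top M.A_pos.le
  have hc : Continuous fun q : Fin K → ℝ => |m| + (|(M.U x).toReal| + (∑ k, x k * q k) / M.V) := by
    fun_prop
  refine (M.integrable_continuous_queue hW hq₀ hc t).mono'
    ((M.measurable_util.comp (M.measurable_queue hW t)).aestronglyMeasurable)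
    (ae_of_all _ fun ω => ?_)
  set q := M.queue q₀ (fun s => W s ω) t
  have hq : 0 ≤ q := M.queue_nonneg hq₀ _ t
  obtain ⟨h1, h2⟩ := M.util_spec hq hx hUx
  have h3 : M.util q ≤ m := by
    have := hm _ (M.arrival_mem q)
    rw [← h1] at this
    exact_mod_cast this
  have h4 : 0 ≤ ∑ k, M.arrival q k * q k :=
    Finset.sum_nonneg fun k _ => mul_nonneg (M.arrival_mem q k).1 (hq k)
  have h5 : 0 ≤ ∑ k, x k * q k := Finset.sum_nonneg fun k _ => mul_nonneg (hx k).1 (hq k)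
  have h6 : (M.U x).toReal - (∑ k, x k * q k) / M.V ≤ M.util q := by
    rw [sub_le_iff_le_add, ← sub_le_iff_le_add', le_div_iff₀ M.V_pos]
    linarith
  have h7 := div_nonneg h5 M.V_pos.le
  rw [Real.norm_eq_abs, abs_le]
  constructor
  · linarith [neg_abs_le (M.U x).toReal, abs_nonneg m]
  · linarith [le_abs_self m, abs_nonneg (M.U x).toReal]

theorem integrable_queue (hW : ∀ t, Measurable (W t)) (hq₀ : 0 ≤ q₀) (t : ℕ) (k : Fin K) :
    Integrable (fun ω => M.queue q₀ (fun s => W s ω) t k) μ :=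
  M.integrable_continuous_queue hW hq₀ (continuous_apply k) t

theorem mean_queue_le (hW : ∀ t, Measurable (W t)) (hq₀ : 0 ≤ q₀) (t : ℕ) (k : Fin K) :
    (∫ ω, M.queue q₀ (fun s => W s ω) t k ∂μ) ^ 2 ≤
      ∫ ω, ∑ k, M.queue q₀ (fun s => W s ω) t k ^ 2 ∂μ := by
  have hc1 : Continuous fun q : Fin K → ℝ => ∑ k, q k ^ 2 := by fun_prop
  have hc2 : Continuous fun q : Fin K → ℝ => q k ^ 2 := by fun_prop
  have i1 := M.integrable_queue (μ := μ) hW hq₀ t k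
  have i2 := M.integrable_continuous_queue (μ := μ) hW hq₀ hc2 t
  have h1 : (∫ ω, M.queue q₀ (fun s => W s ω) t k ∂μ) ^ 2 ≤
      ∫ ω, M.queue q₀ (fun s => W s ω) t k ^ 2 ∂μ := by
    set e := ∫ ω, M.queue q₀ (fun s => W s ω) t k ∂μ with he
    have h2 : ∫ ω, (2 * e * M.queue q₀ (fun s => W s ω) t k - e ^ 2) ∂μ ≤
        ∫ ω, M.queue q₀ (fun s => W s ω) t k ^ 2 ∂μ :=
      integral_mono ((i1.const_mul _).sub (integrable_const _)) i2 fun ω => by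
        simp only
        nlinarith [sq_nonneg (e - M.queue q₀ (fun s => W s ω) t k)]
    rw [integral_sub (i1.const_mul _) (integrable_const _), integral_const_mul, ← he] at h2
    simp only [integral_const, probReal_univ, one_smul] at h2
    nlinarith
  refine h1.trans (integral_mono i2 (M.integrable_continuous_queue hW hq₀ hc1 t) fun ω => ?_)
  exact Finset.single_le_sum (f := fun k => M.queue q₀ (fun s => W s ω) t k ^ 2)
      (fun _ _ => sq_nonneg _) (Finset.mem_univ k)

theorem tendsto_mean_queue_div (hW : ∀ t, Measurable (W t)) (hq₀ : 0 ≤ q₀)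
    (hs : Summable fun t : ℕ => (∫ ω, ∑ k, M.queue q₀ (fun s => W s ω) t k ^ 2 ∂μ) *
      (((t : ℝ) + 1) ^ 2)⁻¹) (k : Fin K) :
    Tendsto (fun n : ℕ => (∫ ω, M.queue q₀ (fun s => W s ω) n k ∂μ) / ((n : ℝ) + 1)) atTop
      (𝓝 0) := by
  have h2 : Tendsto (fun t : ℕ => ((∫ ω, M.queue q₀ (fun s => W s ω) t k ∂μ) /
      ((t : ℝ) + 1)) ^ 2) atTop (𝓝 0) := by
    refine squeeze_zero (fun t => sq_nonneg _) (fun t => ?_) hs.tendsto_atTop_zero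
    rw [div_pow, div_eq_mul_inv]
    exact mul_le_mul_of_nonneg_right (M.mean_queue_le hW hq₀ t k) (by positivity)
  have h3 := h2.sqrt
  rw [Real.sqrt_zero] at h3
  refine h3.congr fun t => Real.sqrt_sq (div_nonneg (integral_nonneg fun ω =>
    M.queue_nonneg hq₀ _ t k) (by positivity))

theorem integrable_arrival_queue (hW : ∀ t, Measurable (W t)) (t : ℕ) :
    Integrable (fun ω => M.arrival (M.queue q₀ (fun s => W s ω) t)) μ := by
  refine Integrable.of_bound (C := M.A) ((M.measurable_arrival.comp
    (M.measurable_queue hW t)).aestronglyMeasurable) (ae_of_all _ fun ω => ?_)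
  refine (pi_norm_le_iff_of_nonneg M.A_pos.le).2 fun k => ?_
  obtain ⟨h1, h2⟩ := M.arrival_mem (M.queue q₀ (fun s => W s ω) t) k
  rwa [Real.norm_of_nonneg h1]

/-- Given the past, the mean rates lie in the region by `mean_rate_mem`, and a closed convex set
contains the expectations of its random points. -/
theorem mean_rate_queue_mem (hW : ∀ t, Measurable (W t)) (hlaw : ∀ t, μ.map (W t) = M.law)
    (hind : iIndepFun W μ) (t : ℕ) :
    (fun k => ∫ ω, M.rate (M.queue q₀ (fun s => W s ω) t) (W t ω) k ∂μ) ∈ M.region := by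
  have h : ∀ k, Integrable (fun ω => M.meanRate (M.queue q₀ (fun s => W s ω) t) k) μ ∧
      ∫ ω, M.rate (M.queue q₀ (fun s => W s ω) t) (W t ω) k ∂μ =
      ∫ ω, M.meanRate (M.queue q₀ (fun s => W s ω) t) k ∂μ := fun k =>
    integral_past hW hlaw hind (M.measurable_queue_past (q₀ := q₀) hW t)
      (M.measurable_rate_apply k) (M.integrable_rate_queue hW hlaw t k)
  have hi : Integrable (fun ω => M.meanRate (M.queue q₀ (fun s => W s ω) t)) μ :=
    Integrable.of_eval fun k => (h k).1
  have h1 : ∫ ω, M.meanRate (M.queue q₀ (fun s => W s ω) t) ∂μ ∈ M.region :=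
    M.region_convex.integral_mem M.region_closed
    (ae_of_all μ fun ω => M.mean_rate_mem (M.queue q₀ (fun s => W s ω) t)) hi
  convert h1 using 1
  ext k
  rw [(h k).2, eval_integral fun k => (h k).1]

/-- The time-averaged expected utility of the arrivals is asymptotically at most the optimum. -/
theorem eventually_mean_util_lt (hW : ∀ t, Measurable (W t)) (hlaw : ∀ t, μ.map (W t) = M.law)
    (hind : iIndepFun W μ) (hq₀ : 0 ≤ q₀) {r Rs : Fin K → ℝ} (hr : r ∈ M.region)
    (hr0 : ∀ k, 0 < r k) (hRs : Rs ∈ M.region ∩ box K M.A) (hURs : M.U Rs ≠ ⊥)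
    (hopt : ∀ x ∈ M.region ∩ box K M.A, M.U x ≤ M.U Rs) {y : ℝ} (hy : (M.U Rs).toReal < y) :
    ∀ᶠ n : ℕ in atTop, (1 / (n : ℝ)) * ∑ τ ∈ Finset.Icc 1 n,
      ∫ ω, M.util (M.queue q₀ (fun s => W s ω) τ) ∂μ < y := by
  obtain ⟨C, hC0, hC⟩ := M.exists_stable_constant hr hr0 hRs hURs
  have hs := M.summable_mean_sq hW hlaw hind hq₀ hC0 hC
  have hy' : M.U Rs < y := by
    rw [← EReal.coe_toReal (M.U_ne_top Rs (nonneg_of_mem_box hRs.2)) hURs]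
    exact_mod_cast hy
  have harr : ∀ τ, (∫ ω, M.arrival (M.queue q₀ (fun s => W s ω) τ) ∂μ) ∈ box K M.A := fun τ =>
    (convex_box K M.A).integral_mem (isCompact_box K M.A).isClosed
      (ae_of_all _ fun ω => M.arrival_mem _) (M.integrable_arrival_queue hW τ)
  have hhyp : ∀ τ, (∫ ω, M.arrival (M.queue q₀ (fun s => W s ω) τ) ∂μ,
      ∫ ω, M.util (M.queue q₀ (fun s => W s ω) τ) ∂μ) ∈ hypograph M.U := by
    intro τ
    have i1 := M.integrable_arrival_queue (μ := μ) (q₀ := q₀) hW τ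
    have i2 := M.integrable_util_queue (μ := μ) hW hq₀ hRs.2 hURs τ
    have h := (convex_hypograph M.U_conc).integral_mem (isClosed_hypograph M.U_cont)
      (ae_of_all μ fun ω => M.hypograph_util_mem
        (M.queue_nonneg hq₀ (fun s => W s ω) τ) hRs.2 hURs) (i1.prodMk i2)
    rwa [integral_pair i1 i2] at h
  -- Averaged mean arrivals exceed averaged mean rates, a point of the region, by at most `E Q[n+1]
  -- / n`.
  have h1 := eventually_utility_lt M.U_cont M.region_closed M.region_lower M.region_nonneg hopt
    (a := fun n => (1 / (n : ℝ)) • ∑ τ ∈ Finset.Icc 1 n,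
      ∫ ω, M.arrival (M.queue q₀ (fun s => W s ω) τ) ∂μ)
    (b := fun n => (1 / (n : ℝ)) • ∑ τ ∈ Finset.Icc 1 n,
      fun k => ∫ ω, M.rate (M.queue q₀ (fun s => W s ω) τ) (W τ ω) k ∂μ)
    (ε := fun n k => (∫ ω, M.queue q₀ (fun s => W s ω) (n + 1) k ∂μ) / (n : ℝ))
    (by
      filter_upwards [eventually_gt_atTop 0] with n hn
      exact average_mem (convex_box K M.A) harr hn)
    (by
      filter_upwards [eventually_gt_atTop 0] with n hn
      exact average_mem M.region_convex (fun τ => M.mean_rate_queue_mem hW hlaw hind τ) hn)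
    (tendsto_pi_nhds.2 fun k => tendsto_succ_div (M.tendsto_mean_queue_div hW hq₀ hs k))
    (Eventually.of_forall fun n k => by
      have i1 : ∀ τ ∈ Finset.Icc 1 n, Integrable
          (fun ω => M.arrival (M.queue q₀ (fun s => W s ω) τ) k) μ := fun τ _ =>
        (M.integrable_arrival_queue hW τ).eval k
      have i2 : ∀ τ ∈ Finset.Icc 1 n, Integrable
          (fun ω => M.rate (M.queue q₀ (fun s => W s ω) τ) (W τ ω) k) μ := fun τ _ =>
        M.integrable_rate_queue hW hlaw τ k
      have i3 := M.integrable_queue (μ := μ) hW hq₀ (n + 1) k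
      have h2 := integral_mono (μ := μ) (integrable_finsetSum _ i1)
        ((integrable_finsetSum _ i2).add i3)
        fun ω => M.sum_arrival_le q₀ hq₀ (fun s => W s ω) k n
      rw [integral_finsetSum _ i1, integral_add' (integrable_finsetSum _ i2) i3,
        integral_finsetSum _ i2] at h2
      have h3 : ∀ τ, (∫ ω, M.arrival (M.queue q₀ (fun s => W s ω) τ) ∂μ) k =
          ∫ ω, M.arrival (M.queue q₀ (fun s => W s ω) τ) k ∂μ := fun τ =>
        eval_integral (fun k => (M.integrable_arrival_queue (q₀ := q₀) hW τ).eval k) k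
      simp only [Pi.smul_apply, Pi.add_apply, Finset.sum_apply, smul_eq_mul, h3]
      calc _ ≤ (1 / (n : ℝ)) * (∑ τ ∈ Finset.Icc 1 n,
            ∫ ω, M.rate (M.queue q₀ (fun s => W s ω) τ) (W τ ω) k ∂μ +
            ∫ ω, M.queue q₀ (fun s => W s ω) (n + 1) k ∂μ) := by gcongr
        _ = _ := by ring) hy'
  filter_upwards [h1, eventually_gt_atTop 0] with n hn hn0
  -- Jensen over time; Jensen over the randomness is in `hhyp`.
  have h2 := (average_mem (convex_hypograph M.U_conc) hhyp hn0).2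
  simp only [Prod.smul_fst, Prod.smul_snd, Prod.fst_sum, Prod.snd_sum, smul_eq_mul] at h2
  exact_mod_cast h2.trans_lt hn

/-- The competitor is `β R`: max-weight against `R` itself covers its share `β` and leaves `1 - β`
of the weighted queue sum as negative drift. -/
theorem mean_drift_le (hW : ∀ t, Measurable (W t)) (hlaw : ∀ t, μ.map (W t) = M.law)
    (hind : iIndepFun W μ) (hq₀ : 0 ≤ q₀) {R : Fin K → ℝ} (hR : R ∈ M.region ∩ box K M.A)
    {β : ℝ} (hβ0 : 0 ≤ β) (hβ1 : β < 1) (hU : M.U (β • R) ≠ ⊥) (t : ℕ) :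
    ∫ ω, ∑ k, M.queue q₀ (fun s => W s ω) (t + 1) k ^ 2 ∂μ ≤
      ∫ ω, ∑ k, M.queue q₀ (fun s => W s ω) t k ^ 2 ∂μ + ∫ w, M.incr w ∂M.law +
      2 * (M.V * ∫ ω, M.util (M.queue q₀ (fun s => W s ω) t) ∂μ - M.V * (M.U (β • R)).toReal
        - (1 - β) * ∑ k, R k * ∫ ω, M.queue q₀ (fun s => W s ω) t k ∂μ) := by
  have hc1 : Continuous fun q : Fin K → ℝ => ∑ k, q k ^ 2 := by fun_prop
  have hβR : β • R ∈ box K M.A := fun k => by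
    obtain ⟨h1, h2⟩ := hR.2 k
    refine ⟨mul_nonneg hβ0 h1, ?_⟩
    simp only [Pi.smul_apply, smul_eq_mul]
    nlinarith
  have hc3 : Continuous fun q : Fin K → ℝ => ∑ k, R k * q k := by fun_prop
  have i0 := M.integrable_continuous_queue (μ := μ) hW hq₀ hc1 (t + 1)
  have i1 := M.integrable_continuous_queue (μ := μ) hW hq₀ hc1 t
  have i2 := M.integrable_comp_slot hW hlaw M.integrable_incr t
  have i3 := (M.integrable_util_queue (μ := μ) hW hq₀ hβR hU t).const_mul (2 * M.V)
  have i4 := (M.integrable_continuous_queue (μ := μ) hW hq₀ hc3 t).const_mul (2 * (1 - β))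
  have i5 := ((M.memLp_noise_queue hW hlaw hind hq₀ t).1.integrable (by norm_num)).const_mul 2
  have i6 : Integrable (fun _ : Ω => 2 * (M.V * (M.U (β • R)).toReal)) μ := integrable_const _
  have i12 := i1.add i2
  have i123 := i12.add i3
  have i1234 := i123.sub i4
  have i12345 := i1234.add i5
  have h := integral_mono i0 (i12345.sub i6) fun ω => by
    have hq := M.queue_nonneg hq₀ (fun s => W s ω) t
    have h1 := M.drift_le hq hβR hU (W t ω)
    have h2 := M.max_weight _ hq R hR.1
    have h3 : ∑ k, (β • R) k * M.queue q₀ (fun s => W s ω) t k =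
        β * ∑ k, R k * M.queue q₀ (fun s => W s ω) t k := by
      rw [Finset.mul_sum]
      exact Finset.sum_congr rfl fun k _ => by simp [mul_assoc]
    have h4 : ∑ k, M.queue q₀ (fun s => W s ω) t k * R k =
        ∑ k, R k * M.queue q₀ (fun s => W s ω) t k :=
      Finset.sum_congr rfl fun k _ => mul_comm _ _
    rw [h3] at h1
    rw [h4] at h2
    simp only [Pi.add_apply, Pi.sub_apply]
    change ∑ k, M.step (M.queue q₀ (fun s => W s ω) t) (W t ω) k ^ 2 ≤ _
    simp only [meanRate] at h1
    linarith
  rw [integral_sub' i12345 i6, integral_add' i1234 i5, integral_sub' i123 i4, integral_add' i12 i3,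
    integral_add' i1 i2, integral_const_mul, integral_const_mul, integral_const_mul,
    M.integral_noise_queue hW hlaw hind hq₀ t, M.integral_comp_slot hW hlaw M.measurable_incr,
    integral_finsetSum _ fun k _ => (M.integrable_queue hW hq₀ t k).const_mul _] at h
  simp only [integral_const, probReal_univ, one_smul, integral_const_mul] at h
  linarith

theorem sum_mean_queue_le (hW : ∀ t, Measurable (W t)) (hlaw : ∀ t, μ.map (W t) = M.law)
    (hind : iIndepFun W μ) (hq₀ : 0 ≤ q₀) {R : Fin K → ℝ} (hR : R ∈ M.region ∩ box K M.A)
    {β : ℝ} (hβ0 : 0 ≤ β) (hβ1 : β < 1) (hU : M.U (β • R) ≠ ⊥) (n : ℕ) :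
    ∫ ω, ∑ k, M.queue q₀ (fun s => W s ω) (n + 1) k ^ 2 ∂μ ≤
      ∫ ω, ∑ k, M.queue q₀ (fun s => W s ω) 1 k ^ 2 ∂μ + n * ∫ w, M.incr w ∂M.law +
      2 * (M.V * ∑ τ ∈ Finset.Icc 1 n, ∫ ω, M.util (M.queue q₀ (fun s => W s ω) τ) ∂μ
        - n * (M.V * (M.U (β • R)).toReal)
        - (1 - β) * ∑ τ ∈ Finset.Icc 1 n,
          ∑ k, R k * ∫ ω, M.queue q₀ (fun s => W s ω) τ k ∂μ) := by
  induction n with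
  | zero => simp
  | succ n ih =>
    have h := M.mean_drift_le hW hlaw hind hq₀ hR hβ0 hβ1 hU (n + 1)
    rw [Finset.sum_Icc_succ_top (by lia), Finset.sum_Icc_succ_top (by lia)]
    push_cast
    linarith

/-- The bound on the weighted time-averaged expected queue sizes. -/
theorem limsup_mean_queue_le (hW : ∀ t, Measurable (W t)) (hlaw : ∀ t, μ.map (W t) = M.law)
    (hind : iIndepFun W μ) (hq₀ : 0 ≤ q₀) {r Rs : Fin K → ℝ} (hr : r ∈ M.region)
    (hr0 : ∀ k, 0 < r k) (hRs : Rs ∈ M.region ∩ box K M.A) (hURs : M.U Rs ≠ ⊥)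
    (hopt : ∀ x ∈ M.region ∩ box K M.A, M.U x ≤ M.U Rs) {R : Fin K → ℝ}
    (hR : R ∈ M.region ∩ box K M.A) {β : ℝ} (hβ0 : 0 ≤ β) (hβ1 : β < 1) :
    limsup (fun n : ℕ => (((1 / (n : ℝ)) * ∑ τ ∈ Finset.Icc 1 n, ∑ k,
        R k * ∫ ω, M.queue q₀ (fun s => W s ω) τ k ∂μ : ℝ) : EReal)) atTop ≤
      (((1 / 2 * ∫ w, M.incr w ∂M.law : ℝ) : EReal) + (M.V : EReal) * (M.U Rs - M.U (β • R))) /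
        ((1 - β : ℝ) : EReal) := by
  have hb : 0 < 1 - β := by linarith
  have hV := M.V_pos
  have hUu := EReal.coe_toReal (M.U_ne_top Rs (nonneg_of_mem_box hRs.2)) hURs
  have hβR0 : 0 ≤ β • R := smul_nonneg hβ0 (nonneg_of_mem_box hR.2)
  by_cases hU : M.U (β • R) = ⊥
  · have : (((1 / 2 * ∫ w, M.incr w ∂M.law : ℝ) : EReal) +
        (M.V : EReal) * (M.U Rs - M.U (β • R))) / ((1 - β : ℝ) : EReal) = ⊤ := by
      rw [hU, ← hUu, EReal.coe_sub_bot, EReal.coe_mul_top_of_pos hV, EReal.coe_add_top,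
        EReal.top_div_of_pos_ne_top (by exact_mod_cast hb) (EReal.coe_ne_top _)]
    rw [this]
    exact le_top
  have hUβ := EReal.coe_toReal (M.U_ne_top _ hβR0) hU
  set κ := 1 / 2 * ∫ w, M.incr w ∂M.law with hκ
  set u := (M.U Rs).toReal with hu
  set uβ := (M.U (β • R)).toReal with huβ
  rw [← hUu, ← hUβ, ← EReal.coe_sub, ← EReal.coe_mul, ← EReal.coe_add, ← EReal.coe_div,
    limsup_le_iff]
  intro y hy
  obtain ⟨y', hy1, hy2⟩ := EReal.lt_iff_exists_real_btwn.1 hy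
  have hy3 : (κ + M.V * (u - uβ)) / (1 - β) < y' := by exact_mod_cast hy1
  -- `η` is the available margin: half of it absorbs the excess of the mean utility over `u`, the
  -- other half the initial term `s / 2`.
  set η := (1 - β) * y' - (κ + M.V * (u - uβ)) with hη
  have hη0 : 0 < η := by
    rw [div_lt_iff₀ hb] at hy3
    linarith
  have h1 := M.eventually_mean_util_lt hW hlaw hind hq₀ hr hr0 hRs hURs hopt
    (y := u + η / (2 * M.V)) (by have : 0 < η / (2 * M.V) := by positivity
                                 linarith)
  set s := ∫ ω, ∑ k, M.queue q₀ (fun s => W s ω) 1 k ^ 2 ∂μ with hs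
  have h2 : Tendsto (fun n : ℕ => 1 / (n : ℝ) * s) atTop (𝓝 0) := by
    simpa using (tendsto_one_div_atTop_nhds_zero_nat (𝕜 := ℝ)).mul_const s
  filter_upwards [h1, h2.eventually (gt_mem_nhds hη0), eventually_gt_atTop 0] with n hn1 hn2 hn3
  refine lt_trans ?_ hy2
  rw [EReal.coe_lt_coe_iff]
  have hn : (0 : ℝ) < n := by exact_mod_cast hn3
  have h3 := M.sum_mean_queue_le hW hlaw hind hq₀ hR hβ0 hβ1 hU n
  have h4 : 0 ≤ ∫ ω, ∑ k, M.queue q₀ (fun s => W s ω) (n + 1) k ^ 2 ∂μ :=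
    integral_nonneg fun _ => Finset.sum_nonneg fun _ _ => sq_nonneg _
  set X := ∑ τ ∈ Finset.Icc 1 n, ∑ k, R k * ∫ ω, M.queue q₀ (fun s => W s ω) τ k ∂μ with hX
  set Y := ∑ τ ∈ Finset.Icc 1 n, ∫ ω, M.util (M.queue q₀ (fun s => W s ω) τ) ∂μ with hY
  rw [← huβ] at h3
  have hn1' : Y < n * (u + η / (2 * M.V)) := by
    rw [one_div_mul_eq_div, div_lt_iff₀ hn] at hn1; linarith
  have hn2' : s < n * η := by
    rw [one_div_mul_eq_div, div_lt_iff₀ hn] at hn2; linarith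
  have hn4 : M.V * Y < n * (M.V * u + η / 2) := by
    have := mul_lt_mul_of_pos_left hn1' hV
    calc M.V * Y < M.V * (n * (u + η / (2 * M.V))) := this
      _ = n * (M.V * u + η / 2) := by field_simp
  rw [one_div_mul_eq_div, div_lt_iff₀ hn]
  refine lt_of_mul_lt_mul_left ?_ hb.le
  have h5 : (1 - β) * (y' * n) = n * η + n * (κ + M.V * (u - uβ)) := by rw [hη]; ring
  rw [h5]
  have h6 : ∫ w, M.incr w ∂M.law = 2 * κ := by rw [hκ]; ring
  rw [h6] at h3
  nlinarith

theorem stronglyStable (hW : ∀ t, Measurable (W t)) (hlaw : ∀ t, μ.map (W t) = M.law)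
    (hind : iIndepFun W μ) (hq₀ : 0 ≤ q₀) {r Rs : Fin K → ℝ} (hr : r ∈ M.region)
    (hr0 : ∀ k, 0 < r k) (hRs : Rs ∈ M.region ∩ box K M.A) (hURs : M.U Rs ≠ ⊥) (k : Fin K) :
    StronglyStable μ fun t ω => M.queue q₀ (fun s => W s ω) t k := by
  obtain ⟨C, hC0, hC⟩ := M.exists_stable_constant hr hr0 hRs hURs
  refine ⟨fun t => M.integrable_queue hW hq₀ t k, ?_⟩
  -- From `x ≤ 1 + x²` and the second-moment sum over `n + 1` slots, with `(n + 1) / n ≤ 2`.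
  set b := 1 + (∑ k, q₀ k ^ 2) ^ 2 + 2 * C with hb
  refine lt_of_le_of_lt (b := (b : EReal)) ?_ (EReal.coe_lt_top b)
  refine limsup_le_of_le (h := ?_)
  filter_upwards [eventually_gt_atTop 0] with n hn
  rw [EReal.coe_le_coe_iff]
  have hn' : (1 : ℝ) ≤ n := by exact_mod_cast hn
  have h1 := M.sum_mean_sq_le hW hlaw hind hq₀ hC (n + 1)
  set e : ℕ → ℝ := fun t => ∫ ω, ∑ k, M.queue q₀ (fun s => W s ω) t k ^ 2 ∂μ with he
  have he0 : ∀ t, 0 ≤ e t := fun t =>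
    integral_nonneg fun _ => Finset.sum_nonneg fun _ _ => sq_nonneg _
  have h2 : ∑ τ ∈ Finset.Icc 1 n, ∫ ω, M.queue q₀ (fun s => W s ω) τ k ∂μ ≤
      ∑ τ ∈ Finset.Icc 1 n, (1 + e τ) := Finset.sum_le_sum fun τ _ => by
    have h3 := M.mean_queue_le (μ := μ) hW hq₀ τ k
    simp only [he]
    nlinarith [sq_nonneg ((∫ ω, M.queue q₀ (fun s => W s ω) τ k ∂μ) - 1)]
  have h3 : ∑ τ ∈ Finset.Icc 1 n, e τ ≤ ∑ τ ∈ Finset.range (n + 1), e τ := by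
    refine Finset.sum_le_sum_of_subset_of_nonneg (fun τ hτ => ?_) fun τ _ _ => he0 τ
    rw [Finset.mem_Icc] at hτ
    rw [Finset.mem_range]
    lia
  rw [Finset.sum_add_distrib] at h2
  simp only [Finset.sum_const, Nat.card_Icc, add_tsub_cancel_right, nsmul_eq_mul, mul_one] at h2
  rw [one_div_mul_eq_div, div_le_iff₀ (by linarith)]
  push_cast at h1
  have h4 : 0 ≤ (∑ k, q₀ k ^ 2) ^ 2 := sq_nonneg _
  nlinarith

theorem exists_optimal (hne : M.region.Nonempty) :
    ∃ Rs, Rs ∈ M.region ∩ box K M.A ∧ ∀ x ∈ M.region ∩ box K M.A, M.U x ≤ M.U Rs := by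
  obtain ⟨z, hz⟩ := hne
  have h0 : (0 : Fin K → ℝ) ∈ M.region := M.region_lower z hz 0 le_rfl (M.region_nonneg z hz)
  obtain ⟨y, hy, hmax⟩ := ((isCompact_box K M.A).inter_left M.region_closed).exists_isMaxOn
    ⟨0, h0, fun k => ⟨le_rfl, M.A_pos.le⟩⟩
    (M.U_cont.mono fun x hx => nonneg_of_mem_box hx.2)
  exact ⟨y, hy, fun x hx => hmax hx⟩

end Trajectories

end DriftModel

open scoped ComplexOrder

/-! ### Pathwise bounds on rates and interference. -/

section Bounds

variable {M K : ℕ}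

theorem sqNorm_nonneg (x : Fin M → ℂ) : 0 ≤ sqNorm x := Finset.sum_nonneg fun _ _ => sq_nonneg _

/-- Only an inequality: where the zero-forcing column vanishes, division by zero makes the steering
vector `0`. -/
theorem sqNorm_steering_le_one (H : Channel M K) (S : Finset (Fin K)) (k : Fin K) :
    sqNorm (steering H S k) ≤ 1 := by
  have h : sqNorm (steering H S k) = sqNorm (zfColumn H S k) / sqNorm (zfColumn H S k) := by
    conv_lhs => unfold sqNorm steering
    simp only [norm_div, Complex.norm_real, Real.norm_eq_abs, div_pow, sq_abs,
      Real.sq_sqrt (sqNorm_nonneg _)]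
    rw [← Finset.sum_div]
    rfl
  rw [h]
  exact div_self_le_one _

theorem norm_dotProduct_sq_le (x y : Fin M → ℂ) :
    ‖star x ⬝ᵥ y‖ ^ 2 ≤ sqNorm x * sqNorm y := by
  have h1 : ‖star x ⬝ᵥ y‖ ≤ ∑ m, ‖x m‖ * ‖y m‖ := by
    refine (norm_sum_le _ _).trans (le_of_eq (Finset.sum_congr rfl fun m _ => ?_))
    simp
  exact (pow_le_pow_left₀ (norm_nonneg _) h1 2).trans (Finset.sum_mul_sq_le_sq_mul_sq _ _ _)

/-- The largest mutual information a user can have. -/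
noncomputable def infoBound (g : ℝ) (h : Fin M → ℂ) (χ : ℝ) : ℝ :=
  Real.logb 2 (1 + g * sqNorm h / (1 + χ))

theorem infoBound_nonneg {g χ : ℝ} (hg : 0 ≤ g) (hχ : 0 ≤ χ) (h : Fin M → ℂ) :
    0 ≤ infoBound g h χ :=
  Real.logb_nonneg one_lt_two (le_add_of_nonneg_right
    (div_nonneg (mul_nonneg hg (sqNorm_nonneg h)) (by linarith)))

theorem mutualInfo_le {g χ : ℝ} (hg : 0 ≤ g) (hχ : 0 ≤ χ) (H : Channel M K) {P : Fin K → ℝ}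
    {k : Fin K} (hP0 : 0 ≤ P k) (hP1 : P k ≤ 1) : mutualInfo g H χ P k ≤ infoBound g (H k) χ := by
  have h1 : ‖star (H k) ⬝ᵥ steering H (active P) k‖ ^ 2 * P k ≤ sqNorm (H k) := by
    have h2 := norm_dotProduct_sq_le (H k) (steering H (active P) k)
    have h3 := mul_le_mul_of_nonneg_left (sqNorm_steering_le_one H (active P) k)
      (sqNorm_nonneg (H k))
    have h4 := mul_le_mul_of_nonneg_left hP1
      (sq_nonneg ‖star (H k) ⬝ᵥ steering H (active P) k‖)
    linarith
  have h0 : 0 ≤ ‖star (H k) ⬝ᵥ steering H (active P) k‖ ^ 2 * P k := by positivity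
  unfold mutualInfo infoBound
  refine Real.logb_le_logb_of_le one_lt_two ?_ ?_
  · rw [mul_assoc]; positivity
  · rw [mul_assoc]; gcongr

theorem outageRate_nonneg (g : ℝ) (H : Channel M K) (χ : ℝ) {a : Action K} {k : Fin K}
    (ha : 0 ≤ a.2 k) : 0 ≤ outageRate g H χ a k := by
  unfold outageRate
  split_ifs
  exacts [ha, le_rfl]

theorem Feasible.power_le_one {a : Action K} (ha : Feasible M a) (k : Fin K) : a.1 k ≤ 1 :=
  (Finset.single_le_sum (f := a.1) (fun j _ => ha.1 j) (Finset.mem_univ k)).trans ha.2.1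

theorem outageRate_le {g χ : ℝ} (hg : 0 ≤ g) (hχ : 0 ≤ χ) (H : Channel M K) {a : Action K}
    (ha : Feasible M a) (k : Fin K) : outageRate g H χ a k ≤ infoBound g (H k) χ := by
  unfold outageRate
  split_ifs with h
  · exact h.trans (mutualInfo_le hg hχ H (ha.1 k) (ha.power_le_one k))
  · exact infoBound_nonneg hg hχ _

/-- The inequality `log y ≤ 4 y^(1/4)` trades the fourth power for linear growth, with `4⁴ = 256`.
Second moments of the channel coefficients therefore suffice for fourth moments of the rates. -/
theorem infoBound_pow_four_le {g χ : ℝ} (hg : 0 ≤ g) (hχ : 0 ≤ χ) (h : Fin M → ℂ) :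
    infoBound g h χ ^ 4 ≤ 256 / Real.log 2 ^ 4 * (1 + g * sqNorm h) := by
  have hs : 0 ≤ g * sqNorm h := mul_nonneg hg (sqNorm_nonneg h)
  have hl : 0 < Real.log 2 := Real.log_pos one_lt_two
  have h1 : infoBound g h χ ≤ Real.logb 2 (1 + g * sqNorm h) := by
    refine Real.logb_le_logb_of_le one_lt_two (by positivity) ?_
    gcongr
    exact div_le_self hs (by linarith)
  refine (pow_le_pow_left₀ (infoBound_nonneg hg hχ h) h1 4).trans ?_
  have h2 : Real.log (1 + g * sqNorm h) ≤ (1 + g * sqNorm h) ^ (1 / 4 : ℝ) / (1 / 4) :=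
    Real.log_le_rpow_div (by positivity) (by norm_num)
  have h3 : 0 ≤ Real.log (1 + g * sqNorm h) := Real.log_nonneg (by linarith)
  have h4 := pow_le_pow_left₀ h3 h2 4
  have h5 : ((1 + g * sqNorm h) ^ (1 / 4 : ℝ)) ^ 4 = 1 + g * sqNorm h := by
    rw [← Real.rpow_natCast, ← Real.rpow_mul (by positivity)]
    norm_num
  rw [div_pow, h5] at h4
  rw [Real.logb, div_pow, div_mul_eq_mul_div]
  gcongr
  norm_num at h4
  linarith

theorem posSemidef_txCov (H : Channel M K) {P : Fin K → ℝ} (hP : ∀ k, 0 ≤ P k) :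
    (txCov H P).PosSemidef :=
  Matrix.posSemidef_sum _ fun k _ => (Matrix.posSemidef_vecMulVec_self_star _).smul
    (by exact_mod_cast hP k)

variable {C : ℕ}

theorem ici_nonneg {g : Fin K → Fin C → Fin C → ℝ} (hg : ∀ k c c', 0 ≤ g k c c') (c : Fin C)
    (γ : {c' : Fin C // c' ≠ c} → Policy M K) (w : Slot M K C) (k : Fin K) :
    0 ≤ ici g c γ w k :=
  Finset.sum_nonneg fun c' _ => mul_nonneg (hg _ _ _)
    ((posSemidef_txCov _ ((γ c').feasible _ _).1).re_dotProduct_nonneg _)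

end Bounds

/-! ### Measurability of steering vectors, interference and rates. -/

section Measurability

variable {M K C : ℕ}

theorem measurable_sqNorm : Measurable (sqNorm : (Fin M → ℂ) → ℝ) := by
  unfold sqNorm; fun_prop

theorem measurable_zfColumn (S : Finset (Fin K)) (k : Fin K) :
    Measurable fun H : Channel M K => zfColumn H S k := by
  refine measurable_pi_lambda _ fun m => ?_
  unfold zfColumn
  by_cases hk : k ∈ S
  -- The inverse is written as inverse determinant times adjugate: continuous functions of `H`,
  -- apart from inversion in `ℂ`, which is measurable also at `0`.
  · simp only [hk, dite_true, Matrix.mul_apply, Matrix.inv_def, Ring.inverse_eq_inv',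
        Matrix.smul_apply,
      smul_eq_mul]
    have hHS : Continuous fun H : Channel M K =>
        (Matrix.of fun (m : Fin M) (j : S) => H j.1 m) :=
      continuous_matrix fun i j => by fun_prop
    have hG : Continuous fun H : Channel M K =>
        (Matrix.of fun (m : Fin M) (j : S) => H j.1 m)ᴴ *
          (Matrix.of fun (m : Fin M) (j : S) => H j.1 m) :=
      hHS.matrix_conjTranspose.matrix_mul hHS
    refine Finset.measurable_sum _ fun j _ => ?_
    have h1 : Measurable fun H : Channel M K =>
        (Matrix.of fun (m : Fin M) (j : S) => H j.1 m) m j :=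
      (hHS.matrix_elem m j).measurable
    have h2 := hG.matrix_det.measurable
    have h3 := (hG.matrix_adjugate.matrix_elem j ⟨k, hk⟩).measurable
    exact h1.mul (h2.inv.mul h3)
  · simp only [hk, dite_false]
    exact measurable_const

theorem measurable_steering (k : Fin K) :
    Measurable fun p : Channel M K × (Fin K → ℝ) => steering p.1 (active p.2) k := by
  have h1 : ∀ S : Finset (Fin K), Measurable fun H : Channel M K => steering H S k := by
    intro S
    refine measurable_pi_lambda _ fun m => ?_
    have h2 := measurable_zfColumn (M := M) S k
    have h3 : Measurable fun H : Channel M K => zfColumn H S k m := (measurable_pi_apply m).comp h2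
    have h4 := measurable_sqNorm.comp h2
    exact h3.div (Complex.measurable_ofReal.comp h4.sqrt)
  have h2 : ∀ S : Finset (Fin K),
        MeasurableSet {p : Channel M K × (Fin K → ℝ) | active p.2 = S} := by
    intro S
    have : {p : Channel M K × (Fin K → ℝ) | active p.2 = S} =
        ⋂ j, {p | 0 < p.2 j ↔ j ∈ S} := by
      ext p
      simp [active, Finset.ext_iff]
    rw [this]
    refine MeasurableSet.iInter fun j => ?_
    have hm : MeasurableSet {p : Channel M K × (Fin K → ℝ) | 0 < p.2 j} :=
      measurableSet_lt measurable_const (by fun_prop)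
    by_cases hj : j ∈ S
    · simpa [hj] using hm
    · simp only [hj, iff_false]
      exact hm.compl
  -- The active set takes finitely many values, so the map is a finite sum of pieces cut out by
  -- measurable sets.
  have h3 : (fun p : Channel M K × (Fin K → ℝ) => steering p.1 (active p.2) k) = fun p =>
      ∑ S : Finset (Fin K), {p : Channel M K × (Fin K → ℝ) | active p.2 = S}.indicator
        (fun p => steering p.1 S k) p := by
    ext1 p
    rw [Finset.sum_eq_single (active p.2)]
    · simp
    · intro S _ hS
      simp [hS.symm]
    · simp
  rw [h3]
  exact Finset.measurable_sum _ fun S _ => ((h1 S).comp measurable_fst).indicator (h2 S)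

theorem measurable_ownChannel (c : Fin C) :
    Measurable (ownChannel c : Slot M K C → Channel M K) := by
  unfold ownChannel; fun_prop

theorem Policy.measurable_act_slot (η : Policy M K) (c : Fin C) :
    Measurable fun w : Slot M K C => η.act (ownChannel c w) (w.2 c) :=
  η.measurable_act.comp ((measurable_ownChannel c).prodMk (by fun_prop))

theorem measurable_ici (g : Fin K → Fin C → Fin C → ℝ) (c : Fin C)
    (γ : {c' : Fin C // c' ≠ c} → Policy M K) : Measurable (ici g c γ) := by
  refine measurable_pi_lambda _ fun k => ?_
  unfold ici
  refine Finset.measurable_sum _ fun c' _ => Measurable.const_mul ?_ _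
  refine Complex.measurable_re.comp ?_
  have hP : Measurable fun w : Slot M K C =>
      ((γ c').act (ownChannel c'.1 w) (w.2 c')).1 := ((γ c').measurable_act_slot c'.1).fst
  have hs : ∀ j m, Measurable fun w : Slot M K C => steering (ownChannel c'.1 w)
      (active ((γ c').act (ownChannel c'.1 w) (w.2 c')).1) j m := fun j m =>
    (measurable_pi_apply m).comp
      ((measurable_steering j).comp ((measurable_ownChannel c'.1).prodMk hP))
  have hPj : ∀ j, Measurable fun w : Slot M K C =>
      (((γ c').act (ownChannel c'.1 w) (w.2 c')).1 j : ℂ) := fun j =>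
    Complex.measurable_ofReal.comp ((measurable_pi_apply j).comp hP)
  have hh : ∀ m, Measurable fun w : Slot M K C => w.1 k c c' m := fun m => by fun_prop
  simp only [dotProduct, Matrix.mulVec, txCov, Matrix.sum_apply, Matrix.smul_apply,
    Matrix.vecMulVec_apply, Pi.star_apply, smul_eq_mul]
  refine Finset.measurable_sum _ fun m _ => (continuous_star.measurable.comp (hh m)).mul
        (Finset.measurable_sum _ fun m' _ => ?_)
  exact (Finset.measurable_sum _ fun j _ => (hPj j).mul
        ((hs j m).mul (continuous_star.measurable.comp (hs j m')))).mul (hh m')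

theorem measurable_outageRate (g : ℝ) (k : Fin K) :
    Measurable fun p : Channel M K × ℝ × Action K => outageRate g p.1 p.2.1 p.2.2 k := by
  have hs : ∀ m, Measurable fun p : Channel M K × ℝ × Action K =>
      steering p.1 (active p.2.2.1) k m := fun m =>
    (measurable_pi_apply m).comp ((measurable_steering k).comp
      (measurable_fst.prodMk measurable_snd.snd.fst))
  have hd : Measurable fun p : Channel M K × ℝ × Action K =>
      star (p.1 k) ⬝ᵥ steering p.1 (active p.2.2.1) k := by
    simp only [dotProduct, Pi.star_apply]
    exact Finset.measurable_sum _ fun m _ => Measurable.mul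
      (continuous_star.measurable.comp (by fun_prop)) (hs m)
  have hI : Measurable fun p : Channel M K × ℝ × Action K => mutualInfo g p.1 p.2.1 p.2.2.1 k := by
    unfold mutualInfo Real.logb
    fun_prop
  have hr : Measurable fun p : Channel M K × ℝ × Action K => p.2.2.2 k := by fun_prop
  unfold outageRate
  exact Measurable.ite (measurableSet_le hr hI) hr measurable_const

theorem measurable_infoBound (g : ℝ) :
    Measurable fun p : (Fin M → ℂ) × ℝ => infoBound g p.1 p.2 := by
  have := measurable_sqNorm (M := M)
  unfold infoBound Real.logb
  fun_prop

end Measurability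

/-! ### The law of a slot and its second moments. -/

section Law

variable {M K C : ℕ}

theorem measurable_complex_mk : Measurable (fun p : ℝ × ℝ => (⟨p.1, p.2⟩ : ℂ)) :=
  Complex.measurableEquivRealProd.symm.measurable

instance : IsProbabilityMeasure cGauss :=
  Measure.isProbabilityMeasure_map measurable_complex_mk.aemeasurable

instance : IsProbabilityMeasure (slotLaw M K C) := by
  unfold slotLaw; infer_instance

theorem integrable_norm_sq_cGauss : Integrable (fun z : ℂ => ‖z‖ ^ 2) cGauss := by
  rw [cGauss, integrable_map_measure (by fun_prop) measurable_complex_mk.aemeasurable]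
  have h : Integrable (fun x : ℝ => x ^ 2) (gaussianReal 0 (1 / 2)) :=
    (memLp_id_gaussianReal (μ := 0) (v := 1 / 2) 2).integrable_sq
  refine ((h.comp_fst (gaussianReal 0 (1 / 2))).add
    (h.comp_snd (gaussianReal 0 (1 / 2)))).congr (ae_of_all _ fun p => ?_)
  simp only [Function.comp_apply, Complex.sq_norm, Complex.normSq_apply, Pi.add_apply]
  ring

theorem measurePreserving_coefficient (k : Fin K) (c c' : Fin C) (m : Fin M) :
    MeasurePreserving (fun w : Slot M K C => w.1 k c c' m) (slotLaw M K C) cGauss :=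
  (measurePreserving_eval (fun _ : Fin M => cGauss) m).comp
    ((measurePreserving_eval (fun _ : Fin C => Measure.pi fun _ : Fin M => cGauss) c').comp
      ((measurePreserving_eval (fun _ : Fin C => Measure.pi fun _ : Fin C =>
          Measure.pi fun _ : Fin M => cGauss) c).comp
        ((measurePreserving_eval (fun _ : Fin K => Measure.pi fun _ : Fin C =>
          Measure.pi fun _ : Fin C => Measure.pi fun _ : Fin M => cGauss) k).comp
          measurePreserving_fst)))

theorem integrable_sqNorm (k : Fin K) (c c' : Fin C) :
    Integrable (fun w : Slot M K C => sqNorm (w.1 k c c')) (slotLaw M K C) :=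
  integrable_finsetSum _ fun m _ =>
    (measurePreserving_coefficient k c c' m).integrable_comp_of_integrable integrable_norm_sq_cGauss

end Law

/-! ### Independence of interference and own channels, by merging two independent slots. -/

section Resampling

theorem measurePreserving_prodProdProdComm {α β : Type*} [MeasurableSpace α] [MeasurableSpace β]
    (μ : Measure α) (ν : Measure β) [IsProbabilityMeasure μ] [IsProbabilityMeasure ν] :
    MeasurePreserving (fun p : (α × β) × α × β => ((p.1.1, p.2.1), (p.1.2, p.2.2)))
      ((μ.prod ν).prod (μ.prod ν)) ((μ.prod μ).prod (ν.prod ν)) := by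
  have h1 := measurePreserving_prodAssoc μ ν (μ.prod ν)
  have h2 := (MeasurePreserving.id μ).prod (measurePreserving_prodAssoc ν μ ν).symm
  have h3 := (MeasurePreserving.id μ).prod
    ((Measure.measurePreserving_swap (μ := ν) (ν := μ)).prod (MeasurePreserving.id ν))
  have h4 := (MeasurePreserving.id μ).prod (measurePreserving_prodAssoc μ ν ν)
  have h5 := (measurePreserving_prodAssoc μ μ (ν.prod ν)).symm
  exact h5.comp (h4.comp (h3.comp (h2.comp h1)))

theorem measurePreserving_pi_merge {ι α : Type*} [Fintype ι] [MeasurableSpace α]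
    (μ : ι → Measure α) [∀ i, IsProbabilityMeasure (μ i)] {f : ι → α × α → α}
    (hf : ∀ i, MeasurePreserving (f i) ((μ i).prod (μ i)) (μ i)) :
    MeasurePreserving (fun (p : (ι → α) × (ι → α)) i => f i (p.1 i, p.2 i))
      ((Measure.pi μ).prod (Measure.pi μ)) (Measure.pi μ) :=
  (measurePreserving_pi _ _ hf).comp (measurePreserving_arrowProdEquivProdArrow α α ι μ μ).symm

variable {M K C : ℕ}

/-- The slot with the own-cell channels and seed of the first slot, and everything else from the
second one. -/
def mergeSlot (c : Fin C) (p : Slot M K C × Slot M K C) : Slot M K C :=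
  (fun k c₁ c₂ => if c₁ = c ∧ c₂ = c then p.1.1 k c₁ c₂ else p.2.1 k c₁ c₂,
    fun c' => if c' = c then p.1.2 c' else p.2.2 c')

theorem measurePreserving_ite {α : Type*} [MeasurableSpace α] (μ : Measure α)
    [IsProbabilityMeasure μ] (P : Prop) [Decidable P] :
    MeasurePreserving (fun p : α × α => if P then p.1 else p.2) (μ.prod μ) μ := by
  by_cases h : P
  · simpa only [h, if_true] using measurePreserving_fst
  · simpa only [h, if_false] using measurePreserving_snd

/-- Each coordinate is taken from one of two independent copies, and the choice depends on the index
alone, so the product law is preserved. -/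
theorem measurePreserving_mergeSlot (c : Fin C) :
    MeasurePreserving (mergeSlot c) ((slotLaw M K C).prod (slotLaw M K C)) (slotLaw M K C) := by
  have h1 := measurePreserving_pi_merge (fun _ : Fin K => Measure.pi fun _ : Fin C =>
      Measure.pi fun _ : Fin C => Measure.pi fun _ : Fin M => cGauss)
    fun _ => measurePreserving_pi_merge _ fun c₁ => measurePreserving_pi_merge _ fun c₂ =>
      measurePreserving_ite (Measure.pi fun _ : Fin M => cGauss) (c₁ = c ∧ c₂ = c)
  have h2 := measurePreserving_pi_merge (fun _ : Fin C => (volume : Measure unitInterval))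
    fun c' => measurePreserving_ite _ (c' = c)
  exact (h1.prod h2).comp (measurePreserving_prodProdProdComm _ _)

theorem ownChannel_mergeSlot (c : Fin C) (p : Slot M K C × Slot M K C) :
    ownChannel c (mergeSlot c p) = ownChannel c p.1 := by
  ext k m; simp [ownChannel, mergeSlot]

theorem seed_mergeSlot (c : Fin C) (p : Slot M K C × Slot M K C) :
    (mergeSlot c p).2 c = p.1.2 c := by
  simp [mergeSlot]

theorem ici_mergeSlot (g : Fin K → Fin C → Fin C → ℝ) (c : Fin C)
    (γ : {c' : Fin C // c' ≠ c} → Policy M K) (p : Slot M K C × Slot M K C) :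
    ici g c γ (mergeSlot c p) = ici g c γ p.2 := by
  ext k
  unfold ici
  refine Finset.sum_congr rfl fun c' _ => ?_
  have h1 : ownChannel c'.1 (mergeSlot c p) = ownChannel c'.1 p.2 := by
    ext j m; simp [ownChannel, mergeSlot, c'.2]
  have h2 : (mergeSlot c p).2 c' = p.2.2 c' := by simp [mergeSlot, c'.2]
  have h3 : (mergeSlot c p).1 k c c' = p.2.1 k c c' := by simp [mergeSlot, c'.2]
  rw [h1, h2, h3]

end Resampling

variable {M K C : ℕ} {g : Fin K → Fin C → Fin C → ℝ} {c : Fin C}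
  {γ : {c' : Fin C // c' ≠ c} → Policy M K}

theorem measurable_ici_apply (k : Fin K) : Measurable fun w : Slot M K C => ici g c γ w k :=
  (measurable_pi_apply k).comp (measurable_ici g c γ)

theorem measurable_infoBound_slot (k : Fin K) :
    Measurable fun w : Slot M K C => infoBound (g k c c) (w.1 k c c) (ici g c γ w k) := by
  have h1 : Measurable fun w : Slot M K C => w.1 k c c :=
    (measurable_pi_apply k).comp (measurable_ownChannel c)
  exact Measurable.comp (g := fun p : (Fin M → ℂ) × ℝ => infoBound (g k c c) p.1 p.2)
    (f := fun w : Slot M K C => (w.1 k c c, ici g c γ w k)) (measurable_infoBound (g k c c))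
    (h1.prodMk (measurable_ici_apply k))

theorem integrable_infoBound_pow_four (hg : ∀ k c c', 0 ≤ g k c c') (k : Fin K) :
    Integrable (fun w : Slot M K C => infoBound (g k c c) (w.1 k c c) (ici g c γ w k) ^ 4)
      (slotLaw M K C) := by
  have hm := measurable_infoBound_slot (g := g) (γ := γ) k
  refine (((integrable_const (1 : ℝ)).add ((integrable_sqNorm k c c).const_mul (g k c c))).const_mul
    (256 / Real.log 2 ^ 4)).mono' (hm.pow_const 4).aestronglyMeasurable (ae_of_all _ fun w => ?_)
  rw [Real.norm_of_nonneg (pow_nonneg (infoBound_nonneg (hg _ _ _) (ici_nonneg hg c γ w k) _) 4)]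
  exact infoBound_pow_four_le (hg _ _ _) (ici_nonneg hg c γ w k) _

theorem measurable_policy_rate (η : Policy M K) (k : Fin K) :
    Measurable fun p : Slot M K C × Slot M K C => outageRate (g k c c) (ownChannel c p.1)
      (ici g c γ p.2 k) (η.act (ownChannel c p.1) (p.1.2 c)) k := by
  have h1 := measurable_ici_apply (g := g) (γ := γ) k
  exact (measurable_outageRate (g k c c) k).comp (((measurable_ownChannel c).comp
    measurable_fst).prodMk ((h1.comp measurable_snd).prodMk
      ((η.measurable_act_slot c).comp measurable_fst)))

theorem integrable_infoBound (hg : ∀ k c c', 0 ≤ g k c c') (k : Fin K) :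
    Integrable (fun w : Slot M K C => infoBound (g k c c) (w.1 k c c) (ici g c γ w k))
      (slotLaw M K C) := by
  have hm := measurable_infoBound_slot (g := g) (γ := γ) k
  refine ((integrable_const (1 : ℝ)).add (integrable_infoBound_pow_four (γ := γ) hg k)).mono'
    hm.aestronglyMeasurable (ae_of_all _ fun w => ?_)
  have h := infoBound_nonneg (hg k c c) (ici_nonneg hg c γ w k) (w.1 k c c)
  rw [Real.norm_of_nonneg h]
  simp only [Pi.add_apply]
  set x := infoBound (g k c c) (w.1 k c c) (ici g c γ w k)
  nlinarith [sq_nonneg (x ^ 2 - 1 / 2), sq_nonneg (x - 1 / 2)]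

/-- As the interference is independent of the own channels and the seed, it can be averaged out
first. -/
theorem throughput_eq_integral (hg : ∀ k c c', 0 ≤ g k c c') (η : Policy M K) (k : Fin K) :
    Integrable (fun w : Slot M K C => ∫ w', outageRate (g k c c) (ownChannel c w) (ici g c γ w' k)
      (η.act (ownChannel c w) (w.2 c)) k ∂(slotLaw M K C)) (slotLaw M K C) ∧
    throughput g c γ η k = ∫ w, ∫ w', outageRate (g k c c) (ownChannel c w) (ici g c γ w' k)
      (η.act (ownChannel c w) (w.2 c)) k ∂(slotLaw M K C) ∂(slotLaw M K C) := by
  set ν := slotLaw M K C with hν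
  set F : Slot M K C → ℝ := fun w => outageRate (g k c c) (ownChannel c w) (ici g c γ w k)
    (η.act (ownChannel c w) (w.2 c)) k with hF
  have hFm : Measurable F :=
    (measurable_policy_rate (g := g) (c := c) (γ := γ) η k).comp
        (measurable_id.prodMk measurable_id)
  have hFi : Integrable F ν :=
    (integrable_infoBound (γ := γ) hg k).mono' hFm.aestronglyMeasurable (ae_of_all _ fun w => by
      rw [Real.norm_of_nonneg (outageRate_nonneg _ _ _ ((η.feasible _ _).2.2.2 k))]
      exact outageRate_le (hg _ _ _) (ici_nonneg hg c γ w k) _ (η.feasible _ _) k)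
  have hmp := measurePreserving_mergeSlot (M := M) (K := K) c
  -- After merging, the decision sees only the first slot and the interference only the second, so
  -- the integral over the pair is an iterated one.
  have hcomp : F ∘ mergeSlot c = fun p : Slot M K C × Slot M K C => outageRate (g k c c)
      (ownChannel c p.1) (ici g c γ p.2 k) (η.act (ownChannel c p.1) (p.1.2 c)) k := by
    ext p
    simp only [hF, Function.comp_apply, ownChannel_mergeSlot, seed_mergeSlot, ici_mergeSlot]
  have hi : Integrable (F ∘ mergeSlot c) (ν.prod ν) := hmp.integrable_comp_of_integrable hFi
  have h1 : throughput g c γ η k = ∫ p, (F ∘ mergeSlot c) p ∂(ν.prod ν) := by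
    change ∫ w, F w ∂ν = _
    conv_lhs => rw [hν, ← hmp.map_eq]
    rw [integral_map hmp.measurable.aemeasurable hFm.aestronglyMeasurable]
    rfl
  rw [hcomp] at hi h1
  exact ⟨hi.integral_prod_left, by rw [h1, integral_prod _ hi]⟩

theorem weighted_throughput_eq (hg : ∀ k c c', 0 ≤ g k c c') (η : Policy M K) (q : Fin K → ℝ) :
    Integrable (fun w : Slot M K C => weightedRate g c γ (ownChannel c w) q
      (η.act (ownChannel c w) (w.2 c))) (slotLaw M K C) ∧
    ∑ k, q k * throughput g c γ η k = ∫ w, weightedRate g c γ (ownChannel c w) q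
      (η.act (ownChannel c w) (w.2 c)) ∂(slotLaw M K C) := by
  have h := fun k => throughput_eq_integral (γ := γ) hg η k
  refine ⟨integrable_finsetSum _ fun k _ => (h k).1.const_mul _, ?_⟩
  unfold weightedRate
  rw [integral_finsetSum _ fun k _ => (h k).1.const_mul _]
  refine Finset.sum_congr rfl fun k _ => ?_
  rw [integral_const_mul, (h k).2]

/-! ### The throughput region. -/

section Region

theorem throughput_nonneg (η : Policy M K) (k : Fin K) : 0 ≤ throughput g c γ η k :=
  integral_nonneg fun _ => outageRate_nonneg _ _ _ ((η.feasible _ _).2.2.2 k)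

theorem throughput_mem_region (η : Policy M K) : throughput g c γ η ∈ region g c γ :=
  subset_closure (subset_convexHull ℝ _ (Set.mem_iUnion.2
    ⟨η, fun k => ⟨throughput_nonneg η k, le_rfl⟩⟩))

theorem region_subset {s : Set (Fin K → ℝ)} (hs : Convex ℝ s) (hsc : IsClosed s)
    (h : ∀ η : Policy M K, ∀ R, (∀ k, 0 ≤ R k ∧ R k ≤ throughput g c γ η k) → R ∈ s) :
    region g c γ ⊆ s :=
  closure_minimal (convexHull_min (Set.iUnion_subset fun η R hR => h η R hR) hs) hsc

theorem region_nonneg {R : Fin K → ℝ} (hR : R ∈ region g c γ) : 0 ≤ R :=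
  region_subset (convex_Ici 0) isClosed_Ici (fun _ _ hR k => (hR k).1) hR

/-- Scaling coordinates by the factors `x k / z k` in `[0, 1]` is linear and continuous and maps
each generating box into itself, hence also the hull and its closure. -/
theorem region_lower {z x : Fin K → ℝ} (hz : z ∈ region g c γ) (hx : 0 ≤ x) (hxz : x ≤ z) :
    x ∈ region g c γ := by
  set θ : Fin K → ℝ := fun k => x k / z k with hθ
  have hz0 := region_nonneg hz
  have hθ0 : ∀ k, 0 ≤ θ k := fun k => div_nonneg (hx k) (hz0 k)
  have hθ1 : ∀ k, θ k ≤ 1 := fun k => div_le_one_of_le₀ (hxz k) (hz0 k)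
  have hxθ : x = θ * z := by
    ext k
    simp only [hθ, Pi.mul_apply]
    by_cases h : z k = 0
    · have h1 := hxz k
      have h2 : 0 ≤ x k := hx k
      rw [h] at h1
      rw [h, mul_zero]
      exact le_antisymm h1 h2
    · rw [div_mul_cancel₀ _ h]
  rw [hxθ]
  refine map_mem_closure (f := fun y => θ * y) (by fun_prop) hz fun y hy => ?_
  have h1 := Set.mem_image_of_mem (LinearMap.mulLeft ℝ θ) hy
  rw [LinearMap.image_convexHull] at h1
  refine convexHull_mono ?_ h1
  rintro _ ⟨v, hv, rfl⟩
  obtain ⟨η, hη⟩ := Set.mem_iUnion.1 hv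
  refine Set.mem_iUnion.2 ⟨η, fun k => ?_⟩
  obtain ⟨h2, h3⟩ := hη k
  simp only [LinearMap.mulLeft_apply, Pi.mul_apply]
  exact ⟨mul_nonneg (hθ0 k) h2, (mul_le_of_le_one_left h2 (hθ1 k)).trans h3⟩

end Region

/-! ### The adaptive policy as an instance of the abstract network. -/

namespace AdaptivePolicy

variable {U : (Fin K → ℝ) → EReal} {V A : ℝ} (π : AdaptivePolicy g c γ U V A)

/-- The stationary policy that uses the decisions of the adaptive policy for fixed queues. -/
def frozen (q : Fin K → ℝ) : Policy M K where
  act H _ := π.act H q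
  measurable_act := π.measurable_act.comp (measurable_fst.prodMk measurable_const)
  feasible H _ := π.feasible H q

/-- Once interference is averaged out, weighted throughput is the mean of a quantity that `act`
maximizes for almost every channel matrix, whatever the seed of the competing policy. The resulting
inequality cuts out a closed half-space, so it survives convex hull and closure. -/
theorem max_weight (hg : ∀ k c c', 0 ≤ g k c c') {q : Fin K → ℝ} (hq : 0 ≤ q) {R : Fin K → ℝ}
    (hR : R ∈ region g c γ) :
    ∑ k, q k * R k ≤ ∑ k, q k * throughput g c γ (π.frozen q) k := by
  set s : Set (Fin K → ℝ) :=
    {R | ∑ k, q k * R k ≤ ∑ k, q k * throughput g c γ (π.frozen q) k} with hs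
  have hconv : Convex ℝ s := convex_halfSpace_le
    ⟨fun x y => by simp [mul_add, Finset.sum_add_distrib],
      fun a x => by simp [Finset.mul_sum, mul_left_comm]⟩ _
  have hclosed : IsClosed s := isClosed_le (by fun_prop) continuous_const
  refine region_subset hconv hclosed (fun η R hR => ?_) hR
  have h1 := weighted_throughput_eq (γ := γ) hg η q
  have h2 := weighted_throughput_eq (γ := γ) hg (π.frozen q) q
  calc ∑ k, q k * R k ≤ ∑ k, q k * throughput g c γ η k :=
        Finset.sum_le_sum fun k _ => mul_le_mul_of_nonneg_left (hR k).2 (hq k)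
    _ = _ := h1.2
    _ ≤ _ := by
        refine integral_mono_ae h1.1 h2.1 ?_
        filter_upwards [ae_of_ae_map (measurable_ownChannel c).aemeasurable π.act_optimal] with w hw
        exact hw q hq _ (η.feasible _ _)
    _ = _ := h2.2.symm

/-- The queueing model of the adaptive policy. -/
noncomputable def toDriftModel (hg : ∀ k c c', 0 ≤ g k c c')
    (hU_top : ∀ x : Fin K → ℝ, 0 ≤ x → U x ≠ ⊤) (hU_cont : ContinuousOn U (Set.Ici 0))
    (hU_conc : ConcaveOnOrthant U) (hU_mono : MonotoneOn U (Set.Ici 0)) (hV : 0 < V) (hA : 0 < A) :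
    DriftModel K (Slot M K C) where
  law := slotLaw M K C
  isProb := inferInstance
  rate q w k := outageRate (g k c c) (ownChannel c w) (ici g c γ w k) (π.act (ownChannel c w) q) k
  arrival := π.arrival
  bnd w k := infoBound (g k c c) (w.1 k c c) (ici g c γ w k)
  region := region g c γ
  U := U
  V := V
  A := A
  measurable_rate := by
    refine measurable_pi_lambda _ fun k => ?_
    have h1 := measurable_ici_apply (g := g) (γ := γ) k
    have h2 : Measurable fun p : (Fin K → ℝ) × Slot M K C => ownChannel c p.2 :=
      (measurable_ownChannel c).comp measurable_snd
    have h3 : Measurable fun p : (Fin K → ℝ) × Slot M K C => π.act (ownChannel c p.2) p.1 :=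
      π.measurable_act.comp (h2.prodMk measurable_fst)
    exact (measurable_outageRate (g k c c) k).comp (h2.prodMk ((h1.comp measurable_snd).prodMk h3))
  measurable_arrival := π.measurable_arrival
  measurable_bnd := measurable_pi_lambda _ measurable_infoBound_slot
  rate_nonneg q w k := outageRate_nonneg _ _ _ ((π.feasible _ q).2.2.2 k)
  rate_le q w k := outageRate_le (hg _ _ _) (ici_nonneg hg c γ w k) _ (π.feasible _ q) k
  bnd_pow_four := integrable_infoBound_pow_four hg
  V_pos := hV
  A_pos := hA
  U_ne_top := hU_top
  U_cont := hU_cont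
  U_conc := hU_conc
  U_mono := hU_mono
  region_closed := isClosed_closure
  region_convex := (convex_convexHull ℝ _).closure
  region_nonneg _ hz := region_nonneg hz
  region_lower _ hz _ hx hxz := region_lower hz hx hxz
  arrival_mem := π.arrival_mem
  arrival_optimal := π.arrival_optimal
  max_weight _ hq _ hR := π.max_weight hg hq hR
  mean_rate_mem q := throughput_mem_region (π.frozen q)

variable (hg : ∀ k c c', 0 ≤ g k c c')
    (hU_top : ∀ x : Fin K → ℝ, 0 ≤ x → U x ≠ ⊤) (hU_cont : ContinuousOn U (Set.Ici 0))
    (hU_conc : ConcaveOnOrthant U) (hU_mono : MonotoneOn U (Set.Ici 0)) (hV : 0 < V) (hA : 0 < A)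

theorem toDriftModel_queue (q₀ : Fin K → ℝ) (w : ℕ → Slot M K C) (t : ℕ) :
    (π.toDriftModel hg hU_top hU_cont hU_conc hU_mono hV hA).queue q₀ w t = π.queue q₀ w t := by
  induction t with
  | zero => rfl
  | succ t ih =>
    change DriftModel.step _ (DriftModel.queue _ q₀ w t) (w t) = _
    rw [ih]
    rfl

theorem integral_incr_toDriftModel :
    1 / 2 * ∫ w, (π.toDriftModel hg hU_top hU_cont hU_conc hU_mono hV hA).incr w
      ∂(slotLaw M K C) = kappa g c γ A := by
  set D := π.toDriftModel hg hU_top hU_cont hU_conc hU_mono hV hA with hD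
  have h1 : ∀ k, Integrable (fun w => D.bnd w k ^ 2) (slotLaw M K C) := fun k =>
    (D.memLp_bnd_sq k).integrable (by norm_num)
  unfold DriftModel.incr kappa
  rw [integral_add (integrable_const _) (integrable_finsetSum _ fun k _ => h1 k),
    integral_finsetSum _ fun k _ => h1 k]
  simp only [integral_const, probReal_univ, one_smul]
  rfl

end AdaptivePolicy

end MultiCell

/-! ### The main theorem. -/

theorem theorem2 {M K C : ℕ} (hC : 1 < C)
    (g : Fin K → Fin C → Fin C → ℝ) (hg : ∀ k c c', 0 ≤ g k c c')
    (c : Fin C) (γ : {c' : Fin C // c' ≠ c} → MultiCell.Policy M K)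
    -- the utility function, with values in `[-∞, ∞)` on the non-negative orthant
    (U : (Fin K → ℝ) → EReal)
    (hU_top : ∀ x : Fin K → ℝ, 0 ≤ x → U x ≠ ⊤)
    (hU_cont : ContinuousOn U (Set.Ici 0))
    (hU_conc : MultiCell.ConcaveOnOrthant U)
    (hU_mono : MonotoneOn U (Set.Ici 0))
    (hr : ∃ r ∈ MultiCell.region g c γ, (∀ k, 0 < r k) ∧ U ((1 / 2 : ℝ) • r) ≠ ⊥)
    (V A : ℝ) (hV : 0 < V) (hA : 0 < A)
    (π : MultiCell.AdaptivePolicy g c γ U V A) (q₀ : Fin K → ℝ) (hq₀ : 0 ≤ q₀)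
    -- the slots are i.i.d.
    {Ω : Type*} [MeasurableSpace Ω] (μ : Measure Ω) [IsProbabilityMeasure μ]
    (W : ℕ → Ω → MultiCell.Slot M K C) (hW_meas : ∀ t, Measurable (W t))
    (hW_law : ∀ t, μ.map (W t) = MultiCell.slotLaw M K C)
    (hW_indep : iIndepFun W μ) :
    -- the optimization problem restricted to the box has a solution
    (∃ Rs, MultiCell.IsBoxOptimal g c γ U A Rs) ∧
    -- the queue sizes have finite expectations
    (∀ t k, Integrable (fun ω => π.queue q₀ (fun s => W s ω) t k) μ) ∧
    ∀ Rs, MultiCell.IsBoxOptimal g c γ U A Rs →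
      -- (a)
      (∀ᵐ ω ∂μ,
        U Rs - ((MultiCell.kappa g c γ A / V : ℝ) : EReal) ≤
          liminf (fun t : ℕ => U ((1 / (t : ℝ)) •
            ∑ τ ∈ Finset.Icc 1 t, π.rate q₀ (fun s => W s ω) τ)) atTop) ∧
      (U Rs ≠ ⊥ →
        -- (b)
        (∀ R ∈ MultiCell.region g c γ ∩ MultiCell.box K A, ∀ β : ℝ, 0 ≤ β → β < 1 →
          limsup (fun t : ℕ => (((1 / (t : ℝ)) * ∑ τ ∈ Finset.Icc 1 t, ∑ k,
              R k * ∫ ω, π.queue q₀ (fun s => W s ω) τ k ∂μ : ℝ) : EReal)) atTop ≤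
            (((MultiCell.kappa g c γ A : ℝ) : EReal) + (V : EReal) * (U Rs - U (β • R))) /
              ((1 - β : ℝ) : EReal)) ∧
        ∀ k, MultiCell.StronglyStable μ
          (fun t ω => π.queue q₀ (fun s => W s ω) t k)) := by
  set D := π.toDriftModel hg hU_top hU_cont hU_conc hU_mono hV hA
  have hqueue : ∀ (w : ℕ → MultiCell.Slot M K C) t, D.queue q₀ w t = π.queue q₀ w t :=
    π.toDriftModel_queue hg hU_top hU_cont hU_conc hU_mono hV hA q₀
  have hkappa : 1 / 2 * ∫ w, D.incr w ∂D.law = MultiCell.kappa g c γ A :=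
    π.integral_incr_toDriftModel hg hU_top hU_cont hU_conc hU_mono hV hA
  obtain ⟨r, hr, hr0, -⟩ := hr
  refine ⟨D.exists_optimal ⟨r, hr⟩, fun t k => ?_, ?_⟩
  · have h := D.integrable_queue (μ := μ) hW_meas hq₀ t k
    simpa only [hqueue] using h
  rintro Rs ⟨hRs, hopt⟩
  refine ⟨?_, fun hURs => ⟨fun R hR β hβ0 hβ1 => ?_, fun k => ?_⟩⟩
  -- If the optimum is `⊥`, so is the left side of (a).
  · by_cases hURs : U Rs = ⊥
    · simp [hURs]
    · have h := D.ae_le_liminf_utility hW_meas hW_law hW_indep hq₀ hr hr0 hRs hURs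
      rw [hkappa] at h
      filter_upwards [h] with ω hω
      simp only [hqueue] at hω
      exact hω
  · have h := D.limsup_mean_queue_le hW_meas hW_law hW_indep hq₀ hr hr0 hRs hURs hopt hR hβ0 hβ1
    rw [hkappa] at h
    simp only [hqueue] at h
    exact h
  · have h := D.stronglyStable hW_meas hW_law hW_indep hq₀ hr hr0 hRs hURs k
    simpa only [hqueue] using h
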